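/- For $w\in\mathbb C$ let $\mathcal S(w)=\frac{1}{1+|w|^2}\,(2\,\mathrm{Re}\,w,\,2\,\mathrm{Im}\,w,\,|w|^2-1)\in\mathbb S^2\subset\mathbb R^3$, and for $\vec\alpha\in\mathbb R^{10}$ let $$\Psi[\vec\alpha](z)=\frac{(\alpha_1+i\alpha_2)\left(z^2+(\alpha_3+i\alpha_4)z+(\alpha_5+i\alpha_6)\right)}{1-(\alpha_7+i\alpha_8)z-(\alpha_9+i\alpha_{10})z^2}.$$ For $r>0$ put $\vec\alpha_r=(1,0,0,0,0,-2r^2,0,0,0,0)$, so that $\Psi[\vec\alpha_r](z)=(z-r-ir)(z+r+ir)$, and, for $1\le i\le 10$, $$K_i^r=r^{\beta_i}\,\partial_{\alpha_i}\mathcal S(\Psi[\vec\alpha])\big|_{\vec\alpha=\vec\alpha_r},\qquad \beta_i=0\ (i=1,2,5,6),\quad \beta_i=-1\ (i=3,4,7,8),\quad \beta_i=-2\ (i=9,10).$$ Let $\mathcal J^r=(\mathcal J^r_{ij})_{1\le i,j\le 10}$ with $$\mathcal J^r_{ij}=\int_{\mathbb R^2}|\nabla\mathcal S(\Psi[\vec\alpha_r])|^2\,K_i^r\cdot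 K_j^r .$$ **Proposition.** For every $r>0$ the derivatives above exist and the integrals converge absolutely. After reordering the indices as $(1,10,6),(2,9,5),(3,8),(4,7)$ (rows and columns alike), $\mathcal J^r$ equals, for every $r>0$, the block diagonal matrix $\frac{16\pi}{3}\,\mathrm{diag}\{A_1,A_2,A_3,A_4\}$, where, entrywise as $r\to\infty$, $$A_1=\begin{pmatrix}2&-4&\alpha_0\\-4&\lambda_3&\gamma_0\\\alpha_0&\gamma_0&4\end{pmatrix}+O(r^{-6}),\qquad A_2=\begin{pmatrix}2&4&-\alpha_0\\4&\lambda_3&\gamma_0\\-\alpha_0&\gamma_0&4\end{pmatrix}+O(r^{-6}),$$ $$A_3=\begin{pmatrix}\lambda_1&\beta_0-r^{-2}\\\beta_0-r^{-2}&\lambda_2\end{pmatrix}+O(r^{-6}),\qquad A_4=\begin{pmatrix}\lambda_1&r^{-2}-\beta_0\\r^{-2}-\beta_0&\lambda_2\end{pmatrix}+O(r^{-6}),$$ with $\lambda_1=8+\frac14r^{-4}$, $\lambda_2=4+\frac12r^{-4}$, $\lambda_3=8+4r^{-4}$ and some functions $\alpha_0,\beta_0,\gamma_0$ of $r$, each of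 which is $O(r^{-9/2})$ as $r\to\infty$. Moreover $$\det\mathcal J^r=\frac{2^{60}\pi^{10}}{3^{10}}\,r^{-8}+O(r^{-10})\qquad(r\to\infty),$$ and in particular $\det\mathcal J^r\to0$ as $r\to\infty$. -/

import Mathlib

open Filter Topology MeasureTheory Asymptotics

namespace HarmonicGram

noncomputable section

/-- The stereographic parametrization of the unit sphere, `ℂ → 𝕊² ⊆ ℝ³`. -/
def stereo (w : ℂ) : EuclideanSpace ℝ (Fin 3) :=
  !₂[2 * w.re / (1 + ‖w‖ ^ 2), 2 * w.im / (1 + ‖w‖ ^ 2), (‖w‖ ^ 2 - 1) / (1 + ‖w‖ ^ 2)]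

/-- The rational function with the ten real parameters `α₁, …, α₁₀`
(the parameter `αᵢ` of the text is `α (i - 1)` here):
`Ψ = a (z² + b z + c) / (1 - d z - e z²)` with `a = α₁ + i α₂`, `b = α₃ + i α₄`, and so on.
At `a = 1`, `d = e = 0` its derivative in `a₁` is `Ψ` itself, in `b₁` it is `z`, in `c₁` it is `1`,
in `d₁` it is `z Ψ`, in `e₁` it is `z² Ψ`. -/
def Psi (α : Fin 10 → ℝ) (z : ℂ) : ℂ :=
  ((α 0 : ℂ) + Complex.I * α 1) *
      (z ^ 2 + ((α 2 : ℂ) + Complex.I * α 3) * z + ((α 4 : ℂ) + Complex.I * α 5)) /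
    (1 - ((α 6 : ℂ) + Complex.I * α 7) * z - ((α 8 : ℂ) + Complex.I * α 9) * z ^ 2)

/-- The map `𝒮(Ψ[α]) : ℂ → 𝕊²`. -/
def sphereMap (α : Fin 10 → ℝ) (z : ℂ) : EuclideanSpace ℝ (Fin 3) := stereo (Psi α z)

/-- The normalizing exponents `β₁, …, β₁₀`. -/
def beta : Fin 10 → ℤ := ![0, 0, -1, -1, 0, 0, -1, -1, -2, -2]

/-- The kernel field `Kᵢ[α] = r ^ βᵢ ∂_{αᵢ} 𝒮(Ψ[α])`: a real partial derivative in `αᵢ`. -/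
def kernelField (r : ℝ) (α : Fin 10 → ℝ) (i : Fin 10) (z : ℂ) : EuclideanSpace ℝ (Fin 3) :=
  r ^ beta i • deriv (fun t : ℝ => sphereMap (Function.update α i t) z) (α i)

/-- `|∇u|² = |∂ₓ u|² + |∂_y u|²` for `u : ℂ → ℝ³`, with `ℂ = ℝ²`. -/
def gradSq (u : ℂ → EuclideanSpace ℝ (Fin 3)) (z : ℂ) : ℝ :=
  ‖fderiv ℝ u z 1‖ ^ 2 + ‖fderiv ℝ u z Complex.I‖ ^ 2

/-- The integrand `|∇𝒮(Ψ[α])|² Kᵢ[α] · Kⱼ[α]`. -/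
def gramIntegrand (r : ℝ) (α : Fin 10 → ℝ) (i j : Fin 10) (z : ℂ) : ℝ :=
  gradSq (sphereMap α) z * inner ℝ (kernelField r α i z) (kernelField r α j z)

/-- The weighted Gram matrix `𝒥[α]`, the integral being over `ℂ = ℝ²` with Lebesgue measure. -/
def gram (r : ℝ) (α : Fin 10 → ℝ) : Matrix (Fin 10) (Fin 10) ℝ :=
  Matrix.of fun i j => ∫ z : ℂ, gramIntegrand r α i j z

/-- The parameter at which `Ψ` becomes `(z - r - i r)(z + r + i r) = z² - 2 i r²`. -/
def alphaR (r : ℝ) : Fin 10 → ℝ := ![1, 0, 0, 0, 0, -2 * r ^ 2, 0, 0, 0, 0]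

theorem Psi_alphaR (r : ℝ) (z : ℂ) :
    Psi (alphaR r) z = (z - r - Complex.I * r) * (z + r + Complex.I * r) := by
  simp [Psi, alphaR]
  linear_combination (r : ℂ) ^ 2 * Complex.I_sq

/-- `𝒥ʳ = 𝒥[α_r]`. -/
def gramR (r : ℝ) : Matrix (Fin 10) (Fin 10) ℝ := gram r (alphaR r)

/-- The reordering of the ten indices into the groups
`(1, 10, 6)`, `(2, 9, 5)`, `(3, 8)`, `(4, 7)` (zero-based here). -/
def order : (Fin 3 ⊕ Fin 3) ⊕ (Fin 2 ⊕ Fin 2) ≃ Fin 10 :=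
  Equiv.ofBijective
    (Sum.elim (Sum.elim ![0, 9, 5] ![1, 8, 4]) (Sum.elim ![2, 7] ![3, 6])) (by decide)

end

end HarmonicGram

/-! Stereographic projection is conformal, so the inner product of two sphere-valued variations is
the real part of a Hermitian product, scaled by 4 / (1 + |Ψ|²)² (`inner_stereoDeriv`). The ten real
parameters are five complex ones, in which Ψ is holomorphic. The Gram matrix is therefore read off
from a 5 × 5 Hermitian matrix `cGram` built from the fields Ψ, z, 1, zΨ, z²Ψ, with density 128 |z|²
(1 + |Ψ|²)⁻⁴.

At `alphaR r`, w = Ψ(z) = z² - 2ir² is two-to-one with Jacobian 4|z|², so the factor |z|² is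
absorbed by the substitution (`integral_comp_psi`). Fields even in z become polynomials in w. Odd
fields are z times such polynomials, and their products carry the extra factor |z|² = |w + 2ir²|.
Even and odd fields are orthogonal under z ↦ -z.

The even entries are moments of a rotation invariant weight, hence explicit with no error term. For
the odd entries, |w + 2ir²| = 2r² |1 + η| with η = w / (2ir²). Expanding to second order with a
global cubic remainder (`abs_norm_one_add_sub_le`) leaves moments of order at most 5, which
converge, and an error O(r⁻⁶).

The degeneration comes from z²Ψ = w² + 2ir²w: after division by r² its leading part is a multiple of
the field Ψ = w. Only the remainder r⁻²w² keeps the two independent, so each even block has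
determinant 32r⁻⁴, while each odd block has determinant 32 + O(r⁻²). -/

namespace HarmonicGram

/-! ### Conformality of the stereographic parametrization -/

/-- The real differential of `stereo` at `w`, applied to `v`. -/
noncomputable def stereoDeriv (w v : ℂ) : EuclideanSpace ℝ (Fin 3) :=
  (1 + ‖w‖ ^ 2)⁻¹ ^ 2 •
    !₂[2 * v.re * (1 + ‖w‖ ^ 2) - 2 * w.re * (2 * (w.re * v.re + w.im * v.im)),
      2 * v.im * (1 + ‖w‖ ^ 2) - 2 * w.im * (2 * (w.re * v.re + w.im * v.im)),
      4 * (w.re * v.re + w.im * v.im)]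

theorem one_add_norm_sq_pos (w : ℂ) : 0 < 1 + ‖w‖ ^ 2 := by positivity

theorem norm_sq_eq (w : ℂ) : ‖w‖ ^ 2 = w.re ^ 2 + w.im ^ 2 := by
  rw [Complex.sq_norm, Complex.normSq_apply]; ring

/-- Conformality, with factor 2 / (1 + |w|²). The metric of the sphere enters the argument only
through this identity. -/
theorem inner_stereoDeriv (w v v' : ℂ) :
    inner ℝ (stereoDeriv w v) (stereoDeriv w v') =
      4 * (1 + ‖w‖ ^ 2)⁻¹ ^ 2 * (v * starRingEnd ℂ v').re := by
  have h := (one_add_norm_sq_pos w).ne'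
  simp only [stereoDeriv, inner_smul_left, inner_smul_right, PiLp.inner_apply, Fin.sum_univ_three]
  simp only [norm_sq_eq] at *
  simp
  field_simp
  ring

theorem norm_sq_stereoDeriv (w v : ℂ) :
    ‖stereoDeriv w v‖ ^ 2 = 4 * (1 + ‖w‖ ^ 2)⁻¹ ^ 2 * ‖v‖ ^ 2 := by
  rw [← real_inner_self_eq_norm_sq, inner_stereoDeriv, Complex.mul_conj, Complex.ofReal_re,
    Complex.sq_norm v]

theorem hasDerivAt_stereo_comp {φ : ℝ → ℂ} {v : ℂ} {t : ℝ} (h : HasDerivAt φ v t) :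
    HasDerivAt (fun s => stereo (φ s)) (stereoDeriv (φ t) v) t := by
  have hre : HasDerivAt (fun s => (φ s).re) v.re t :=
    (Complex.reCLM.hasFDerivAt.comp_hasDerivAt t h)
  have him : HasDerivAt (fun s => (φ s).im) v.im t :=
    (Complex.imCLM.hasFDerivAt.comp_hasDerivAt t h)
  have hn : HasDerivAt (fun s => ‖φ s‖ ^ 2)
      (2 * ((φ t).re * v.re + (φ t).im * v.im)) t := by
    simp only [norm_sq_eq]
    refine ((hre.pow 2).add (him.pow 2)).congr_deriv ?_
    simp
    ring
  have h0 := (one_add_norm_sq_pos (φ t)).ne'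
  have hd := hn.const_add 1
  suffices H : ∀ i, HasDerivAt (fun s => stereo (φ s) i) (stereoDeriv (φ t) v i) t by
    rw [hasDerivAt_iff_hasFDerivAt, ← hasFDerivWithinAt_univ, hasFDerivWithinAt_euclidean]
    intro i
    rw [hasFDerivWithinAt_univ]
    refine (H i).hasFDerivAt.congr_fderiv ?_
    ext
    simp
  intro i
  fin_cases i
  · refine ((hre.const_mul 2).div hd h0).congr_deriv ?_
    simp [stereoDeriv]
    field_simp
  · refine ((him.const_mul 2).div hd h0).congr_deriv ?_
    simp [stereoDeriv]
    field_simp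
  · refine ((hn.sub_const 1).div hd h0).congr_deriv ?_
    simp [stereoDeriv]
    field_simp
    ring

theorem differentiable_stereo : Differentiable ℝ stereo := by
  rw [differentiable_euclidean]
  have hn : Differentiable ℝ fun w : ℂ => ‖w‖ ^ 2 := differentiable_id.norm_sq ℝ
  have hre : Differentiable ℝ Complex.re := Complex.reCLM.differentiable
  have him : Differentiable ℝ Complex.im := Complex.imCLM.differentiable
  have h0 : ∀ w : ℂ, 1 + ‖w‖ ^ 2 ≠ 0 := fun w => (one_add_norm_sq_pos w).ne'
  have hi : Differentiable ℝ fun w : ℂ => (1 + ‖w‖ ^ 2)⁻¹ :=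
    fun w => (hn.const_add 1 w).fun_inv (h0 w)
  intro i
  fin_cases i
  · change Differentiable ℝ fun w : ℂ => 2 * w.re / (1 + ‖w‖ ^ 2)
    simp only [div_eq_mul_inv]
    exact (hre.const_mul 2).mul hi
  · change Differentiable ℝ fun w : ℂ => 2 * w.im / (1 + ‖w‖ ^ 2)
    simp only [div_eq_mul_inv]
    exact (him.const_mul 2).mul hi
  · change Differentiable ℝ fun w : ℂ => (‖w‖ ^ 2 - 1) / (1 + ‖w‖ ^ 2)
    simp only [div_eq_mul_inv]
    exact (hn.sub_const 1).mul hi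

/-- Restricting to the line t ↦ z + tv reduces the Fréchet derivative to the derivative along a
curve. -/
theorem fderiv_stereo_comp {f : ℂ → ℂ} {f' z : ℂ} (h : HasDerivAt f f' z) (v : ℂ) :
    fderiv ℝ (fun z => stereo (f z)) z v = stereoDeriv (f z) (f' * v) := by
  have hf : DifferentiableAt ℝ f z := h.differentiableAt.restrictScalars ℝ
  have hd : DifferentiableAt ℝ (fun z => stereo (f z)) z :=
    (differentiable_stereo (f z)).comp z hf
  have hl : HasDerivAt (fun t : ℝ => z + t * v) v 0 := by
    simpa using (((Complex.ofRealCLM.hasDerivAt (x := 0)).mul_const v).const_add z)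
  have hz : z + ((0 : ℝ) : ℂ) * v = z := by simp
  have h1 : HasDerivAt (fun t : ℝ => stereo (f (z + t * v)))
      (fderiv ℝ (fun z => stereo (f z)) z v) 0 := by
    have := hd.hasFDerivAt
    rw [← hz] at this
    have := this.comp_hasDerivAt (0 : ℝ) hl
    rwa [hz] at this
  have h2 : HasDerivAt (fun t : ℝ => f (z + t * v)) (f' * v) 0 := by
    rw [← hz] at h
    exact h.comp (0 : ℝ) hl
  have h3 := hasDerivAt_stereo_comp h2
  rw [hz] at h3
  exact h1.unique h3

theorem gradSq_stereo_comp {f : ℂ → ℂ} {f' z : ℂ} (h : HasDerivAt f f' z) :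
    gradSq (fun z => stereo (f z)) z = 8 * (1 + ‖f z‖ ^ 2)⁻¹ ^ 2 * ‖f'‖ ^ 2 := by
  rw [gradSq, fderiv_stereo_comp h, fderiv_stereo_comp h, norm_sq_stereoDeriv,
    norm_sq_stereoDeriv]
  simp
  ring

/-! ### The Gram integrand as the real part of a complex density -/

/-- The quadratic polynomial `Ψ` at the parameter `alphaR r`. -/
noncomputable def psi (r : ℝ) (z : ℂ) : ℂ := z ^ 2 - 2 * Complex.I * r ^ 2

theorem Psi_alphaR_eq (r : ℝ) (z : ℂ) : Psi (alphaR r) z = psi r z := by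
  rw [Psi_alphaR, psi]
  linear_combination -(r : ℂ) ^ 2 * Complex.I_sq

theorem hasDerivAt_psi (r : ℝ) (z : ℂ) : HasDerivAt (psi r) (2 * z) z := by
  have := (hasDerivAt_pow 2 z).sub_const (2 * Complex.I * r ^ 2)
  simp only [Nat.cast_ofNat, Nat.add_one_sub_one, pow_one] at this
  exact this

theorem sphereMap_alphaR (r : ℝ) : sphereMap (alphaR r) = fun z => stereo (psi r z) := by
  ext1 z; rw [sphereMap, Psi_alphaR_eq]

/-- The complex derivatives of `Ψ` in the five complex parameters. -/
noncomputable def dirField (r : ℝ) (k : Fin 5) (z : ℂ) : ℂ :=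
  ![psi r z, z, 1, z * psi r z, z ^ 2 * psi r z] k

/-- The index of the complex parameter of which `αᵢ` is the real or the imaginary part. -/
def cIndex : Fin 10 → Fin 5 := ![0, 0, 1, 1, 2, 2, 3, 3, 4, 4]

/-- The direction of the real parameter `αᵢ` in the corresponding complex plane. -/
noncomputable def cUnit : Fin 10 → ℂ :=
  ![1, Complex.I, 1, Complex.I, 1, Complex.I, 1, Complex.I, 1, Complex.I]

theorem hasDerivAt_Psi_update (r : ℝ) (i : Fin 10) (z : ℂ) :
    HasDerivAt (fun t : ℝ => Psi (Function.update (alphaR r) i t) z)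
      (cUnit i * dirField r (cIndex i) z) (alphaR r i) := by
  -- With every coordinate written as a function of t, one application of the quotient rule covers
  -- all ten parameters; the denominator equals 1 at `alphaR r`.
  have hx : ∀ k : Fin 10, HasDerivAt
      (fun t : ℝ => ((Function.update (alphaR r) i t k : ℝ) : ℂ))
      (if k = i then 1 else 0) (alphaR r i) := by
    intro k
    split_ifs with hk
    · subst hk
      simp only [Function.update_self]
      exact Complex.ofRealCLM.hasDerivAt
    · simpa [Function.update_of_ne hk] using hasDerivAt_const (alphaR r i) ((alphaR r k : ℝ) : ℂ)
  have hnum := ((hx 0).add ((hx 1).const_mul Complex.I)).mul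
    (((((hx 2).add ((hx 3).const_mul Complex.I)).mul_const z).const_add (z ^ 2)).add
      ((hx 4).add ((hx 5).const_mul Complex.I)))
  have hden := ((((hx 6).add ((hx 7).const_mul Complex.I)).mul_const z).const_sub 1).sub
    (((hx 8).add ((hx 9).const_mul Complex.I)).mul_const (z ^ 2))
  have h := hnum.div hden (by simp [alphaR])
  refine h.congr_deriv ?_
  simp only [Pi.add_apply, Pi.mul_apply, Pi.sub_apply, Function.update_eq_self]
  fin_cases i <;> simp [alphaR, cUnit, cIndex, dirField, psi] <;> ring

theorem hasDerivAt_sphereMap_update (r : ℝ) (i : Fin 10) (z : ℂ) :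
    HasDerivAt (fun t : ℝ => sphereMap (Function.update (alphaR r) i t) z)
      (stereoDeriv (psi r z) (cUnit i * dirField r (cIndex i) z)) (alphaR r i) := by
  have := hasDerivAt_stereo_comp (hasDerivAt_Psi_update r i z)
  rwa [Function.update_eq_self, Psi_alphaR_eq] at this

/-- The rotation invariant weight `(1 + |w|²)⁻⁴`. -/
noncomputable def weight (w : ℂ) : ℝ := (1 + ‖w‖ ^ 2)⁻¹ ^ 4

/-- The complex density whose real parts are the Gram integrands. -/
noncomputable def cDensity (r : ℝ) (k l : Fin 5) (z : ℂ) : ℂ :=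
  ((128 * ‖z‖ ^ 2 * weight (psi r z) : ℝ) : ℂ) *
    (dirField r k z * starRingEnd ℂ (dirField r l z))

/-- The gradient and the inner product each contribute (1 + |Ψ|²)⁻², whence the fourth power in
`weight`; the constant is 128 = 8 · 4 · 4, from the gradient, |2z|² and the inner product. -/
theorem gramIntegrand_alphaR (r : ℝ) (i j : Fin 10) (z : ℂ) :
    gramIntegrand r (alphaR r) i j z = r ^ beta i * r ^ beta j *
      (cUnit i * starRingEnd ℂ (cUnit j) * cDensity r (cIndex i) (cIndex j) z).re := by
  rw [gramIntegrand, sphereMap_alphaR, gradSq_stereo_comp (hasDerivAt_psi r z), kernelField,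
    kernelField, (hasDerivAt_sphereMap_update r i z).deriv,
    (hasDerivAt_sphereMap_update r j z).deriv, real_inner_smul_left, real_inner_smul_right,
    inner_stereoDeriv, cDensity, weight]
  have : ∀ a b x y : ℂ, ∀ s : ℝ, (a * starRingEnd ℂ b * (s * (x * starRingEnd ℂ y))).re =
      s * (a * x * starRingEnd ℂ (b * y)).re := by
    intro a b x y s
    rw [← Complex.re_ofReal_mul, map_mul]
    congr 1; ring
  rw [this]
  simp only [norm_mul, Complex.norm_ofNat, mul_pow]
  ring

/-! ### Integrability and radial integrals of the weight -/

theorem weight_nonneg (w : ℂ) : 0 ≤ weight w := by unfold weight; positivity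

theorem continuous_weight : Continuous weight := by
  unfold weight
  exact ((continuous_const.add (continuous_norm.pow 2)).inv₀
    fun w => (one_add_norm_sq_pos w).ne').pow 4

/-- The weight decays like |w|⁻⁸, so growth of degree 5 leaves |w|⁻³, which is integrable in the
plane; degree 6 would not be. -/
theorem one_add_norm_pow_mul_weight_le (w : ℂ) :
    (1 + ‖w‖) ^ 5 * weight w ≤ 16 * (1 + ‖w‖) ^ (-3 : ℝ) := by
  have h1 : (1 + ‖w‖) ^ 2 ≤ 2 * (1 + ‖w‖ ^ 2) := by nlinarith [sq_nonneg (1 - ‖w‖)]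
  have h2 : (1 + ‖w‖) ^ 8 ≤ 16 * (1 + ‖w‖ ^ 2) ^ 4 := by
    calc (1 + ‖w‖) ^ 8 = ((1 + ‖w‖) ^ 2) ^ 4 := by ring
      _ ≤ (2 * (1 + ‖w‖ ^ 2)) ^ 4 := by gcongr
      _ = _ := by ring
  have hp : (0 : ℝ) < 1 + ‖w‖ := by positivity
  have : (1 + ‖w‖) ^ (-3 : ℝ) = ((1 + ‖w‖) ^ 3)⁻¹ := by
    rw [Real.rpow_neg hp.le]; norm_cast
  rw [this, weight, inv_pow, ← div_eq_mul_inv, ← div_eq_mul_inv,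
    div_le_div_iff₀ (by positivity) (by positivity)]
  calc _ = (1 + ‖w‖) ^ 8 := by ring
    _ ≤ _ := h2

theorem integrable_of_norm_le_weight {E : Type*} [NormedAddCommGroup E] {G : ℂ → E}
    (hG : Continuous G) (C : ℝ) (h : ∀ w, ‖G w‖ ≤ C * ((1 + ‖w‖) ^ 5 * weight w)) :
    Integrable G := by
  have hi : Integrable fun w : ℂ => (1 + ‖w‖) ^ (-3 : ℝ) :=
    integrable_one_add_norm (by rw [Complex.finrank_real_complex]; norm_num)
  refine (hi.const_mul (|C| * 16)).mono' hG.aestronglyMeasurable (Eventually.of_forall fun w => ?_)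
  calc ‖G w‖ ≤ C * ((1 + ‖w‖) ^ 5 * weight w) := h w
    _ ≤ |C| * ((1 + ‖w‖) ^ 5 * weight w) :=
      mul_le_mul_of_nonneg_right (le_abs_self C) (mul_nonneg (by positivity) (weight_nonneg w))
    _ ≤ |C| * (16 * (1 + ‖w‖) ^ (-3 : ℝ)) := by
      gcongr |C| * ?_; exact one_add_norm_pow_mul_weight_le w
    _ = _ := by ring

theorem integrable_mul_weight {g : ℂ → ℝ} (hg : Continuous g) (C : ℝ)
    (h : ∀ w, |g w| ≤ C * (1 + ‖w‖) ^ 5) : Integrable fun w => g w * weight w := by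
  refine integrable_of_norm_le_weight (hg.mul continuous_weight) C fun w => ?_
  rw [norm_mul, Real.norm_eq_abs, Real.norm_of_nonneg (weight_nonneg w), ← mul_assoc]
  exact mul_le_mul_of_nonneg_right (h w) (weight_nonneg w)

theorem integrable_norm_pow_mul_weight {n : ℕ} (hn : n ≤ 5) :
    Integrable fun w : ℂ => ‖w‖ ^ n * weight w := by
  refine integrable_mul_weight (by fun_prop) 1 fun w => ?_
  rw [one_mul, abs_of_nonneg (by positivity)]
  calc ‖w‖ ^ n ≤ (1 + ‖w‖) ^ n := by gcongr; simp
    _ ≤ _ := pow_le_pow_right₀ (by simp) hn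

theorem integral_radial (f : ℝ → ℝ) :
    ∫ w : ℂ, f ‖w‖ = 2 * Real.pi * ∫ y in Set.Ioi (0 : ℝ), y * f y := by
  rw [integral_fun_norm_addHaar]
  simp [Measure.real, Complex.volume_ball, Complex.finrank_real_complex]
  ring

theorem integral_norm_pow_mul_weight_of_hasDerivAt {n : ℕ} {F : ℝ → ℝ} {l : ℝ}
    (hF : ∀ y : ℝ, HasDerivAt F (y * (y ^ n * (1 + y ^ 2)⁻¹ ^ 4)) y)
    (h0 : F 0 = 0) (hl : Tendsto F atTop (𝓝 l)) :
    ∫ w : ℂ, ‖w‖ ^ n * weight w = 2 * Real.pi * l := by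
  have h := integral_radial fun y => y ^ n * (1 + y ^ 2)⁻¹ ^ 4
  rw [integral_Ioi_of_hasDerivAt_of_nonneg' (fun y _ => hF y)
    (fun y hy => by have : 0 < y := hy; positivity) hl, h0, sub_zero] at h
  exact h

theorem tendsto_inv_one_add_sq : Tendsto (fun y : ℝ => (1 + y ^ 2)⁻¹) atTop (𝓝 0) :=
  tendsto_inv_atTop_zero.comp
    (tendsto_atTop_add_const_left _ _ (tendsto_pow_atTop two_ne_zero))

theorem hasDerivAt_inv_one_add_sq (y : ℝ) :
    HasDerivAt (fun y : ℝ => (1 + y ^ 2)⁻¹) (-(2 * y) * (1 + y ^ 2)⁻¹ ^ 2) y := by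
  refine (((hasDerivAt_pow 2 y).const_add 1).fun_inv (by positivity)).congr_deriv ?_
  simp [div_eq_mul_inv]

/-- The radial antiderivatives are polynomials in `q = (1 + y²)⁻¹`. -/
theorem hasDerivAt_cubic_inv (a b c d y : ℝ) :
    HasDerivAt (fun y : ℝ => a + b * (1 + y ^ 2)⁻¹ + c * (1 + y ^ 2)⁻¹ ^ 2 + d * (1 + y ^ 2)⁻¹ ^ 3)
      ((b + 2 * c * (1 + y ^ 2)⁻¹ + 3 * d * (1 + y ^ 2)⁻¹ ^ 2) *
        (-(2 * y) * (1 + y ^ 2)⁻¹ ^ 2)) y := by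
  have h := hasDerivAt_inv_one_add_sq y
  refine ((((h.const_mul b).const_add a).add ((h.fun_pow 2).const_mul c)).add
    ((h.fun_pow 3).const_mul d)).congr_deriv ?_
  push_cast
  ring

theorem tendsto_cubic_inv (a b c d : ℝ) :
    Tendsto (fun y : ℝ => a + b * (1 + y ^ 2)⁻¹ + c * (1 + y ^ 2)⁻¹ ^ 2 + d * (1 + y ^ 2)⁻¹ ^ 3)
      atTop (𝓝 a) := by
  have h := tendsto_inv_one_add_sq
  simpa using (((h.const_mul b).const_add a).add ((h.pow 2).const_mul c)).add
    ((h.pow 3).const_mul d)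

/-- With q = (1 + y²)⁻¹ one has y dy = -dq / (2q²) and y² = 1/q - 1, so yⁿ⁺¹q⁴ dy = -½ (1 - q)^(n/2)
q^(2 - n/2) dq. For n = 0, 2, 4 the coefficients here and below are those of the primitive; its
constant term makes F vanish at y = 0 (q = 1) and is then the limit at infinity (q = 0). -/
theorem integral_weight : ∫ w : ℂ, weight w = Real.pi / 3 := by
  have := integral_norm_pow_mul_weight_of_hasDerivAt (n := 0) (l := 1 / 6)
    (fun y => (hasDerivAt_cubic_inv (1 / 6) 0 0 (-1 / 6) y).congr_deriv (by ring))
    (by norm_num) (tendsto_cubic_inv _ _ _ _)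
  simp only [pow_zero, one_mul] at this
  rw [this]; ring

theorem integral_norm_sq_mul_weight : ∫ w : ℂ, ‖w‖ ^ 2 * weight w = Real.pi / 6 := by
  have := integral_norm_pow_mul_weight_of_hasDerivAt (n := 2) (l := 1 / 12)
    (fun y => (hasDerivAt_cubic_inv (1 / 12) 0 (-1 / 4) (1 / 6) y).congr_deriv (by
      have : 1 + y ^ 2 ≠ 0 := by positivity
      field_simp; ring))
    (by norm_num) (tendsto_cubic_inv _ _ _ _)
  rw [this]; ring

theorem integral_norm_pow_four_mul_weight : ∫ w : ℂ, ‖w‖ ^ 4 * weight w = Real.pi / 3 := by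
  have := integral_norm_pow_mul_weight_of_hasDerivAt (n := 4) (l := 1 / 6)
    (fun y => (hasDerivAt_cubic_inv (1 / 6) (-1 / 2) (1 / 2) (-1 / 6) y).congr_deriv (by
      have : 1 + y ^ 2 ≠ 0 := by positivity
      field_simp; ring))
    (by norm_num) (tendsto_cubic_inv _ _ _ _)
  rw [this]; ring

/-! ### Symmetries of the weight and vanishing moments -/

section Symmetry

variable {E : Type*} [NormedAddCommGroup E] [NormedSpace ℝ E]

theorem integral_comp_linearIsometryEquiv (e : ℂ ≃ₗᵢ[ℝ] ℂ) (f : ℂ → E) :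
    ∫ w, f (e w) = ∫ w, f w :=
  e.measurePreserving.integral_comp e.toHomeomorph.measurableEmbedding f

theorem integral_comp_I_mul (f : ℂ → E) : ∫ w, f (Complex.I * w) = ∫ w, f w := by
  have := integral_comp_linearIsometryEquiv (rotation (Circle.exp (Real.pi / 2))) f
  simpa [rotation_apply, Circle.coe_exp, Complex.exp_pi_div_two_mul_I] using this

theorem integral_comp_conj (f : ℂ → E) : ∫ w, f (starRingEnd ℂ w) = ∫ w, f w :=
  integral_comp_linearIsometryEquiv Complex.conjLIE f

theorem integral_eq_zero_of_odd {f : ℂ → E} (h : ∀ w, f (-w) = -f w) : ∫ w, f w = 0 := by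
  have h1 := integral_neg_eq_self f (volume : Measure ℂ)
  simp only [h, integral_neg] at h1
  have h2 : (2 : ℝ) • ∫ w, f w = 0 := by
    rw [two_smul]; nth_rewrite 1 [← h1]; simp
  simpa using h2

end Symmetry

theorem weight_I_mul (w : ℂ) : weight (Complex.I * w) = weight w := by simp [weight]

theorem weight_neg (w : ℂ) : weight (-w) = weight w := by simp [weight]

theorem weight_conj (w : ℂ) : weight (starRingEnd ℂ w) = weight w := by simp [weight]

/-- The weighted moments of `w` and its conjugate. -/
noncomputable def moment (a b : ℕ) : ℂ :=
  ∫ w : ℂ, (w ^ a * starRingEnd ℂ w ^ b) * (weight w : ℂ)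

theorem integrable_moment {a b : ℕ} (h : a + b ≤ 5) :
    Integrable fun w : ℂ => (w ^ a * starRingEnd ℂ w ^ b) * (weight w : ℂ) := by
  have hc := continuous_weight
  refine (integrable_norm_pow_mul_weight h).mono' (by fun_prop)
    (Eventually.of_forall fun w => le_of_eq ?_)
  simp [abs_of_nonneg (weight_nonneg w), pow_add]

/-- A quarter turn preserves the integral and multiplies the integrand by this constant. -/
theorem moment_eq_zero {a b : ℕ} (h : Complex.I ^ a * (-Complex.I) ^ b ≠ 1) :
    moment a b = 0 := by
  have h1 := integral_comp_I_mul fun w : ℂ => (w ^ a * starRingEnd ℂ w ^ b) * (weight w : ℂ)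
  have h2 : ∀ w : ℂ, ((Complex.I * w) ^ a * starRingEnd ℂ (Complex.I * w) ^ b) *
      (weight (Complex.I * w) : ℂ) = (Complex.I ^ a * (-Complex.I) ^ b) *
        ((w ^ a * starRingEnd ℂ w ^ b) * (weight w : ℂ)) := by
    intro w
    rw [weight_I_mul, map_mul, Complex.conj_I, mul_pow, mul_pow]
    ring
  simp only [h2] at h1
  rw [integral_const_mul] at h1
  by_contra h0
  exact h (mul_right_cancel₀ h0 (h1.trans (one_mul _).symm))

theorem moment_self (a : ℕ) : moment a a = ((∫ w : ℂ, ‖w‖ ^ (2 * a) * weight w : ℝ) : ℂ) := by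
  rw [moment, ← integral_complex_ofReal]
  congr 1; ext1 w
  rw [← mul_pow, Complex.mul_conj, Complex.normSq_eq_norm_sq]
  push_cast
  rw [pow_mul]

/-! ### The change of variables w = z² - 2ir² -/

section Squaring

theorem volume_im_eq_zero : volume {z : ℂ | z.im = 0} = 0 := by
  have := Measure.addHaar_submodule (volume : Measure ℂ) (LinearMap.ker Complex.imLm)
    (fun h => by
      have : Complex.I ∈ LinearMap.ker Complex.imLm := h ▸ Submodule.mem_top
      simp at this)
  convert this using 2
  ext; simp

theorem volume_re_eq_zero : volume {z : ℂ | z.re = 0} = 0 := by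
  have := Measure.addHaar_submodule (volume : Measure ℂ) (LinearMap.ker Complex.reLm)
    (fun h => by
      have : (1 : ℂ) ∈ LinearMap.ker Complex.reLm := h ▸ Submodule.mem_top
      simp at this)
  convert this using 2
  ext; simp

theorem slitPlane_ae_eq_univ : Complex.slitPlane =ᵐ[volume] Set.univ := by
  rw [ae_eq_univ]
  refine measure_mono_null (fun z hz => ?_) volume_im_eq_zero
  by_contra h
  exact hz (Or.inr h)

theorem image_sq_rightHalfPlane :
    (fun z : ℂ => z ^ 2) '' {z | 0 < z.re} = Complex.slitPlane := by
  ext w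
  constructor
  · rintro ⟨z, hz, rfl⟩
    have hz : 0 < z.re := hz
    rw [Complex.mem_slitPlane_iff]
    by_cases h : z.im = 0
    · left
      simp only [sq, Complex.mul_re, h]
      nlinarith
    · right
      simp only [sq, Complex.mul_im]
      intro h0
      have : z.re * z.im = 0 := by linarith
      simp [hz.ne', h] at this
  · intro hw
    obtain ⟨z, rfl⟩ := IsAlgClosed.exists_pow_nat_eq w two_pos
    rcases lt_trichotomy z.re 0 with h | h | h
    · exact ⟨-z, by simpa using h, by simp⟩
    · rw [Complex.mem_slitPlane_iff] at hw
      simp only [sq, Complex.mul_re, Complex.mul_im, h] at hw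
      rcases hw with hw | hw
      · nlinarith [mul_self_nonneg z.im]
      · simp at hw
    · exact ⟨z, h, rfl⟩

theorem injOn_sq_rightHalfPlane : Set.InjOn (fun z : ℂ => z ^ 2) {z | 0 < z.re} := by
  intro a ha b hb h
  rcases sq_eq_sq_iff_eq_or_eq_neg.mp h with h | h
  · exact h
  · have ha : 0 < a.re := ha
    have hb : 0 < b.re := hb
    rw [h, Complex.neg_re] at ha
    linarith

theorem abs_det_smul_one (a : ℂ) : |(a • (1 : ℂ →L[ℝ] ℂ)).det| = ‖a‖ ^ 2 := by
  have : (a • (1 : ℂ →L[ℝ] ℂ)).det = Algebra.norm ℝ a := by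
    rw [Algebra.norm_apply]
    rfl
  rw [this, Algebra.norm_complex_apply, Complex.normSq_eq_norm_sq, abs_of_nonneg (by positivity)]

/-- Squaring maps the right half plane injectively onto the slit plane, which has full measure, with
real Jacobian |2z|². The left half plane contributes the same amount by z ↦ -z, whence the factor 2.
-/
theorem integral_comp_sq {G : ℂ → ℂ} (hG : Integrable G) :
    Integrable (fun z : ℂ => ((4 * ‖z‖ ^ 2 : ℝ) : ℂ) * G (z ^ 2)) ∧
      ∫ z : ℂ, ((4 * ‖z‖ ^ 2 : ℝ) : ℂ) * G (z ^ 2) = 2 * ∫ w, G w := by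
  set S : Set ℂ := {z | 0 < z.re}
  set F : ℂ → ℂ := fun z => ((4 * ‖z‖ ^ 2 : ℝ) : ℂ) * G (z ^ 2) with hF
  have hS : MeasurableSet S := measurableSet_lt measurable_const Complex.measurable_re
  have hder : ∀ z ∈ S, HasFDerivWithinAt (fun z : ℂ => z ^ 2)
      ((2 * z) • (1 : ℂ →L[ℝ] ℂ)) S z := fun z _ => by
    have := (hasDerivAt_pow 2 z).complexToReal_fderiv.hasFDerivWithinAt (s := S)
    simpa using this
  have hdet : ∀ z : ℂ, |((2 * z) • (1 : ℂ →L[ℝ] ℂ)).det| • G (z ^ 2) = F z := fun z => by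
    rw [abs_det_smul_one, hF, Complex.real_smul]
    simp only [norm_mul, Complex.norm_ofNat]
    congr 2; ring
  have hint : IntegrableOn F S := by
    have := (integrableOn_image_iff_integrableOn_abs_det_fderiv_smul volume hS hder
      injOn_sq_rightHalfPlane G).mp hG.integrableOn
    simpa only [hdet] using this
  have hval : ∫ z in S, F z = ∫ w, G w := by
    have := integral_image_eq_integral_abs_det_fderiv_smul volume hS hder
      injOn_sq_rightHalfPlane G
    rw [image_sq_rightHalfPlane, setIntegral_congr_set slitPlane_ae_eq_univ,
      setIntegral_univ] at this
    simpa only [hdet] using this.symm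
  have hind : Integrable (S.indicator F) := (integrable_indicator_iff hS).mpr hint
  have hneg : Integrable fun z => S.indicator F (-z) := hind.comp_neg
  have hae : F =ᵐ[volume] fun z => S.indicator F z + S.indicator F (-z) := by
    have h0 : ∀ᵐ z : ℂ, z.re ≠ 0 := by
      rw [ae_iff]; simpa using volume_re_eq_zero
    filter_upwards [h0] with z hz
    have he : F (-z) = F z := by simp [hF]
    rcases lt_or_gt_of_ne hz with h | h
    · have h1 : z ∉ S := fun h' => lt_asymm h h'
      have h2 : -z ∈ S := by simpa [S] using h
      simp [h1, h2, he]
    · have h1 : z ∈ S := h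
      have h2 : -z ∉ S := fun h' => by
        have : 0 < (-z).re := h'
        rw [Complex.neg_re] at this; linarith
      simp [h1, h2]
  refine ⟨(hind.add hneg).congr hae.symm, ?_⟩
  rw [integral_congr_ae hae, integral_add hind hneg, integral_neg_eq_self (S.indicator F),
    integral_indicator hS, hval, two_mul]

theorem integral_comp_psi (r : ℝ) {G : ℂ → ℂ} (hG : Integrable G) :
    Integrable (fun z : ℂ => ((4 * ‖z‖ ^ 2 : ℝ) : ℂ) * G (psi r z)) ∧
      ∫ z : ℂ, ((4 * ‖z‖ ^ 2 : ℝ) : ℂ) * G (psi r z) = 2 * ∫ w, G w := by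
  have h := integral_comp_sq (hG.comp_sub_right (2 * Complex.I * (r : ℂ) ^ 2))
  rwa [integral_sub_right_eq_self G] at h

end Squaring

/-- The bound has to be global, since η = w / (2ir²) runs over the whole plane. For small η, the
difference of the squares of the two quantities is exactly cubic and their sum is bounded below; for
|η| ≥ 1/2, every term is itself dominated by |η|³. -/
theorem abs_norm_one_add_sub_le (η : ℂ) :
    |‖1 + η‖ - (1 + η.re + η.im ^ 2 / 2)| ≤ 25 * ‖η‖ ^ 3 := by
  have hre := Complex.abs_re_le_norm η
  have him := Complex.abs_im_le_norm η
  have hn : 0 ≤ ‖η‖ := norm_nonneg η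
  have hy : η.im ^ 2 ≤ ‖η‖ ^ 2 := by
    rw [← sq_abs]; gcongr
  rw [abs_le] at hre
  rcases le_total ‖η‖ (1 / 2) with h | h
  · set N := ‖1 + η‖ with hN
    set P := 1 + η.re + η.im ^ 2 / 2 with hP
    have hN0 : 0 ≤ N := norm_nonneg _
    have hP2 : 1 / 2 ≤ P := by nlinarith [sq_nonneg η.im]
    have hN2 : N ^ 2 = (1 + η.re) ^ 2 + η.im ^ 2 := by
      rw [hN, norm_sq_eq]; simp
    have hd : (N - P) * (N + P) = -(η.re * η.im ^ 2 + η.im ^ 4 / 4) := by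
      calc _ = N ^ 2 - P ^ 2 := by ring
        _ = _ := by rw [hN2, hP]; ring
    have h1 : |η.re * η.im ^ 2 + η.im ^ 4 / 4| ≤ 2 * ‖η‖ ^ 3 := by
      calc |η.re * η.im ^ 2 + η.im ^ 4 / 4|
          ≤ |η.re * η.im ^ 2| + |η.im ^ 4 / 4| := abs_add_le _ _
        _ = |η.re| * η.im ^ 2 + (η.im ^ 2) ^ 2 / 4 := by
          rw [abs_mul, abs_of_nonneg (sq_nonneg η.im),
            abs_of_nonneg (show 0 ≤ η.im ^ 4 / 4 by positivity)]
          ring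
        _ ≤ ‖η‖ * ‖η‖ ^ 2 + (‖η‖ ^ 2) ^ 2 / 4 := by
          gcongr; exact Complex.abs_re_le_norm η
        _ ≤ _ := by nlinarith [pow_nonneg hn 3]
    have h2 : |N - P| * (1 / 2) ≤ |η.re * η.im ^ 2 + η.im ^ 4 / 4| := by
      rw [← abs_neg (_ + _), ← hd, abs_mul, abs_of_nonneg (show 0 ≤ N + P by linarith)]
      gcongr; linarith
    nlinarith [pow_nonneg hn 3]
  · have h1 : ‖1 + η‖ ≤ 1 + ‖η‖ := by simpa using norm_add_le 1 η
    have h2 : 1 ≤ 4 * ‖η‖ ^ 2 := by nlinarith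
    have h3 : ‖η‖ ^ 2 ≤ 2 * ‖η‖ ^ 3 := by nlinarith [sq_nonneg ‖η‖]
    have h4 : ‖η‖ ≤ 4 * ‖η‖ ^ 3 := by nlinarith
    have := norm_nonneg (1 + η)
    -- Here 1 ≤ 8|η|³, |η| ≤ 4|η|³ and |η|²/2 ≤ |η|³; the constant is 25 = 2 · 8 + 2 · 4 + 1.
    rw [abs_le]
    constructor <;> nlinarith [sq_nonneg η.im]

/-! ### Transport of the density to the variable w -/

/-- `dirField` in the variable `w = Ψ(z)`, up to a factor `z` for odd indices. -/
noncomputable def dirPoly (r : ℝ) (k : Fin 5) (w : ℂ) : ℂ :=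
  ![w, 1, 1, w, w ^ 2 + 2 * Complex.I * r ^ 2 * w] k

theorem dirField_even (r : ℝ) {k : Fin 5} (hk : k = 0 ∨ k = 2 ∨ k = 4) (z : ℂ) :
    dirField r k z = dirPoly r k (psi r z) := by
  rcases hk with rfl | rfl | rfl <;> simp [dirField, dirPoly, psi]
  ring

theorem dirField_odd (r : ℝ) {k : Fin 5} (hk : k = 1 ∨ k = 3) (z : ℂ) :
    dirField r k z = z * dirPoly r k (psi r z) := by
  rcases hk with rfl | rfl <;> simp [dirField, dirPoly]

/-- The image of `cDensity` under `Ψ`, for even indices. -/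
noncomputable def evenDensity (r : ℝ) (k l : Fin 5) (w : ℂ) : ℂ :=
  dirPoly r k w * starRingEnd ℂ (dirPoly r l w) * (weight w : ℂ)

/-- The image of `cDensity` under `Ψ`, for odd indices. -/
noncomputable def oddDensity (r : ℝ) (k l : Fin 5) (w : ℂ) : ℂ :=
  dirPoly r k w * starRingEnd ℂ (dirPoly r l w) *
    ((‖w + 2 * Complex.I * r ^ 2‖ * weight w : ℝ) : ℂ)

theorem cDensity_even (r : ℝ) {k l : Fin 5} (hk : k = 0 ∨ k = 2 ∨ k = 4)
    (hl : l = 0 ∨ l = 2 ∨ l = 4) (z : ℂ) :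
    cDensity r k l z = ((4 * ‖z‖ ^ 2 : ℝ) : ℂ) * (32 * evenDensity r k l (psi r z)) := by
  rw [cDensity, dirField_even r hk, dirField_even r hl, evenDensity]
  push_cast; ring

theorem cDensity_odd (r : ℝ) {k l : Fin 5} (hk : k = 1 ∨ k = 3) (hl : l = 1 ∨ l = 3) (z : ℂ) :
    cDensity r k l z = ((4 * ‖z‖ ^ 2 : ℝ) : ℂ) * (32 * oddDensity r k l (psi r z)) := by
  have h1 : ‖psi r z + 2 * Complex.I * r ^ 2‖ = ‖z‖ ^ 2 := by simp [psi]
  have h2 : z * starRingEnd ℂ z = ((‖z‖ ^ 2 : ℝ) : ℂ) := by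
    rw [Complex.mul_conj, Complex.normSq_eq_norm_sq]
  rw [cDensity, dirField_odd r hk, dirField_odd r hl, oddDensity, h1, map_mul]
  push_cast at h2 ⊢
  linear_combination 128 * (‖z‖ : ℂ) ^ 2 * weight (psi r z) * dirPoly r k (psi r z) *
    starRingEnd ℂ (dirPoly r l (psi r z)) * h2

theorem continuous_dirPoly (r : ℝ) (k : Fin 5) : Continuous (dirPoly r k) := by
  unfold dirPoly
  fin_cases k <;> simp <;> fun_prop

theorem norm_dirPoly_le (r : ℝ) (k : Fin 5) (w : ℂ) :
    ‖dirPoly r k w‖ ≤ (1 + 2 * r ^ 2) * (1 + ‖w‖) ^ 2 := by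
  have hw := norm_nonneg w
  have h1 : 1 ≤ 1 + 2 * r ^ 2 := by nlinarith [sq_nonneg r]
  have h2 : (1 + ‖w‖) ^ 2 ≤ (1 + 2 * r ^ 2) * (1 + ‖w‖) ^ 2 :=
    le_mul_of_one_le_left (by positivity) h1
  have h3 : ‖w‖ ≤ (1 + ‖w‖) ^ 2 := by nlinarith
  have h4 : 1 ≤ (1 + ‖w‖) ^ 2 := by nlinarith
  fin_cases k <;> simp only [dirPoly] <;> simp
  · linarith
  · linarith
  · linarith
  · linarith
  · refine (norm_add_le _ _).trans ?_
    simp only [norm_mul, norm_pow, Complex.norm_ofNat, Complex.norm_I, Complex.norm_real,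
      Real.norm_eq_abs, sq_abs]
    nlinarith [mul_nonneg (sq_nonneg r) hw, mul_nonneg (sq_nonneg r) (sq_nonneg ‖w‖), sq_nonneg r]

theorem norm_dirPoly_odd_le (r : ℝ) {k : Fin 5} (hk : k = 1 ∨ k = 3) (w : ℂ) :
    ‖dirPoly r k w‖ ≤ 1 + ‖w‖ := by
  rcases hk with rfl | rfl <;> simp [dirPoly]

theorem integrable_evenDensity (r : ℝ) (k l : Fin 5) : Integrable (evenDensity r k l) := by
  have h1 := continuous_dirPoly r k
  have h2 := continuous_dirPoly r l
  have h3 := continuous_weight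
  have hc : Continuous (evenDensity r k l) := by
    unfold evenDensity
    exact (h1.mul (Complex.continuous_conj.comp h2)).mul (Complex.continuous_ofReal.comp h3)
  refine integrable_of_norm_le_weight hc ((1 + 2 * r ^ 2) ^ 2) fun w => ?_
  have hw := norm_nonneg w
  have hW := weight_nonneg w
  rw [evenDensity, norm_mul, norm_mul, RCLike.norm_conj, Complex.norm_real, Real.norm_of_nonneg hW]
  calc _ ≤ ((1 + 2 * r ^ 2) * (1 + ‖w‖) ^ 2) * ((1 + 2 * r ^ 2) * (1 + ‖w‖) ^ 2) * weight w := by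
        gcongr <;> exact norm_dirPoly_le r _ w
    _ = (1 + 2 * r ^ 2) ^ 2 * ((1 + ‖w‖) ^ 4 * weight w) := by ring
    _ ≤ _ := by gcongr <;> linarith

theorem integrable_oddDensity (r : ℝ) {k l : Fin 5} (hk : k = 1 ∨ k = 3) (hl : l = 1 ∨ l = 3) :
    Integrable (oddDensity r k l) := by
  have h1 := continuous_dirPoly r k
  have h2 := continuous_dirPoly r l
  have h3 := continuous_weight
  have hc : Continuous (oddDensity r k l) := by
    unfold oddDensity
    exact (h1.mul (Complex.continuous_conj.comp h2)).mul (Complex.continuous_ofReal.comp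
      ((continuous_id.add continuous_const).norm.mul h3))
  refine integrable_of_norm_le_weight hc (1 + 2 * r ^ 2) fun w => ?_
  have hw := norm_nonneg w
  have hW := weight_nonneg w
  have hn : ‖w + 2 * Complex.I * r ^ 2‖ ≤ (1 + 2 * r ^ 2) * (1 + ‖w‖) := by
    refine (norm_add_le _ _).trans ?_
    simp only [norm_mul, norm_pow, Complex.norm_ofNat, Complex.norm_I, Complex.norm_real,
      Real.norm_eq_abs, sq_abs]
    nlinarith [mul_nonneg (sq_nonneg r) hw]
  rw [oddDensity, norm_mul, norm_mul, RCLike.norm_conj, Complex.norm_real, norm_mul, norm_norm,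
    Real.norm_of_nonneg hW]
  calc _ ≤ (1 + ‖w‖) * (1 + ‖w‖) * ((1 + 2 * r ^ 2) * (1 + ‖w‖) * weight w) := by
        gcongr
        · exact norm_dirPoly_odd_le r hk w
        · exact norm_dirPoly_odd_le r hl w
    _ = (1 + 2 * r ^ 2) * ((1 + ‖w‖) ^ 3 * weight w) := by ring
    _ ≤ _ := by gcongr <;> linarith

theorem integral_cDensity_even (r : ℝ) {k l : Fin 5} (hk : k = 0 ∨ k = 2 ∨ k = 4)
    (hl : l = 0 ∨ l = 2 ∨ l = 4) :
    Integrable (cDensity r k l) ∧ ∫ z, cDensity r k l z = 64 * ∫ w, evenDensity r k l w := by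
  have h := integral_comp_psi r ((integrable_evenDensity r k l).const_mul 32)
  simp only [← cDensity_even r hk hl] at h
  refine ⟨h.1, h.2.trans ?_⟩
  rw [integral_const_mul]; ring

theorem integral_cDensity_odd (r : ℝ) {k l : Fin 5} (hk : k = 1 ∨ k = 3) (hl : l = 1 ∨ l = 3) :
    Integrable (cDensity r k l) ∧ ∫ z, cDensity r k l z = 64 * ∫ w, oddDensity r k l w := by
  have h := integral_comp_psi r ((integrable_oddDensity r hk hl).const_mul 32)
  simp only [← cDensity_odd r hk hl] at h
  refine ⟨h.1, h.2.trans ?_⟩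
  rw [integral_const_mul]; ring

theorem even_or_odd (k : Fin 5) : (k = 0 ∨ k = 2 ∨ k = 4) ∨ (k = 1 ∨ k = 3) := by
  fin_cases k <;> simp

theorem integrable_cDensity_self (r : ℝ) (k : Fin 5) : Integrable (cDensity r k k) := by
  rcases even_or_odd k with h | h
  · exact (integral_cDensity_even r h h).1
  · exact (integral_cDensity_odd r h h).1

theorem continuous_psi (r : ℝ) : Continuous (psi r) := by unfold psi; fun_prop

theorem continuous_dirField (r : ℝ) (k : Fin 5) : Continuous (dirField r k) := by
  have := continuous_psi r
  unfold dirField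
  fin_cases k <;> simp <;> fun_prop

theorem continuous_cDensity (r : ℝ) (k l : Fin 5) : Continuous (cDensity r k l) := by
  unfold cDensity
  exact (Complex.continuous_ofReal.comp ((continuous_const.mul (continuous_norm.pow 2)).mul
    (continuous_weight.comp (continuous_psi r)))).mul
      ((continuous_dirField r k).mul (Complex.continuous_conj.comp (continuous_dirField r l)))

theorem norm_cDensity (r : ℝ) (k l : Fin 5) (z : ℂ) :
    ‖cDensity r k l z‖ =
      128 * ‖z‖ ^ 2 * weight (psi r z) * (‖dirField r k z‖ * ‖dirField r l z‖) := by
  rw [cDensity, norm_mul, norm_mul, RCLike.norm_conj, Complex.norm_real, Real.norm_of_nonneg]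
  have := weight_nonneg (psi r z)
  positivity

/-- A product of an even and an odd field is not a function of w, so the substitution does not apply
to it; it is dominated by the sum of the two diagonal densities. -/
theorem integrable_cDensity (r : ℝ) (k l : Fin 5) : Integrable (cDensity r k l) := by
  refine ((integrable_cDensity_self r k).norm.add (integrable_cDensity_self r l).norm).mono'
    (continuous_cDensity r k l).aestronglyMeasurable (Eventually.of_forall fun z => ?_)
  simp only [Pi.add_apply, norm_cDensity]
  have hW : 0 ≤ 128 * ‖z‖ ^ 2 * weight (psi r z) :=
    mul_nonneg (by positivity) (weight_nonneg _)
  rw [← mul_add]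
  refine mul_le_mul_of_nonneg_left ?_ hW
  nlinarith [sq_nonneg (‖dirField r k z‖ - ‖dirField r l z‖), norm_nonneg (dirField r k z),
    norm_nonneg (dirField r l z), sq_nonneg (‖dirField r k z‖ + ‖dirField r l z‖)]

theorem integrable_gramIntegrand (r : ℝ) (i j : Fin 10) :
    Integrable (gramIntegrand r (alphaR r) i j) := by
  have := ((integrable_cDensity r (cIndex i) (cIndex j)).const_mul
    (cUnit i * starRingEnd ℂ (cUnit j))).re.const_mul (r ^ beta i * r ^ beta j)
  refine this.congr (Eventually.of_forall fun z => ?_)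
  rw [gramIntegrand_alphaR]
  rfl

/-! ### The complex Gram matrix and parity -/

/-- The complex Gram matrix, without the normalizing powers of `r`. -/
noncomputable def cGram (r : ℝ) (k l : Fin 5) : ℂ := ∫ z, cDensity r k l z

theorem gramR_apply (r : ℝ) (i j : Fin 10) :
    gramR r i j = r ^ beta i * r ^ beta j *
      (cUnit i * starRingEnd ℂ (cUnit j) * cGram r (cIndex i) (cIndex j)).re := by
  rw [gramR, gram, Matrix.of_apply]
  simp only [gramIntegrand_alphaR]
  rw [integral_const_mul, cGram, ← integral_const_mul (cUnit i * starRingEnd ℂ (cUnit j))]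
  congr 1
  exact integral_re ((integrable_cDensity r (cIndex i) (cIndex j)).const_mul
    (cUnit i * starRingEnd ℂ (cUnit j)))

theorem cGram_conj (r : ℝ) (k l : Fin 5) : cGram r l k = starRingEnd ℂ (cGram r k l) := by
  rw [cGram, cGram, ← integral_conj]
  congr 1; ext1 z
  simp only [cDensity, map_mul, Complex.conj_ofReal, Complex.conj_conj]
  ring

theorem dirField_neg_even (r : ℝ) {k : Fin 5} (hk : k = 0 ∨ k = 2 ∨ k = 4) (z : ℂ) :
    dirField r k (-z) = dirField r k z := by
  rw [dirField_even r hk, dirField_even r hk]; simp [psi]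

theorem dirField_neg_odd (r : ℝ) {k : Fin 5} (hk : k = 1 ∨ k = 3) (z : ℂ) :
    dirField r k (-z) = -dirField r k z := by
  rw [dirField_odd r hk, dirField_odd r hk]; simp [psi]

theorem cGram_even_odd (r : ℝ) {k l : Fin 5} (hk : k = 0 ∨ k = 2 ∨ k = 4) (hl : l = 1 ∨ l = 3) :
    cGram r k l = 0 := by
  refine integral_eq_zero_of_odd fun z => ?_
  have : psi r (-z) = psi r z := by simp [psi]
  rw [cDensity, cDensity, dirField_neg_even r hk, dirField_neg_odd r hl, this]
  simp

theorem cGram_odd_even (r : ℝ) {k l : Fin 5} (hk : k = 1 ∨ k = 3) (hl : l = 0 ∨ l = 2 ∨ l = 4) :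
    cGram r k l = 0 := by
  rw [cGram_conj, cGram_even_odd r hl hk, map_zero]

/-! ### Even entries, in closed form -/

section EvenEntries

theorem moment_zero_zero : moment 0 0 = Real.pi / 3 := by
  rw [moment_self]; simp [integral_weight]

theorem moment_one_one : moment 1 1 = Real.pi / 6 := by
  rw [moment_self, mul_one, integral_norm_sq_mul_weight]; simp

theorem moment_two_two : moment 2 2 = Real.pi / 3 := by
  rw [moment_self, integral_norm_pow_four_mul_weight]; simp

theorem I_ne_one : Complex.I ≠ 1 := fun h => by simpa using congrArg Complex.im h

theorem neg_I_ne_one : -Complex.I ≠ 1 := fun h => by simpa using congrArg Complex.im h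

theorem moment_one_zero : moment 1 0 = 0 := moment_eq_zero (by simpa using I_ne_one)

theorem moment_zero_one : moment 0 1 = 0 := moment_eq_zero (by simpa using neg_I_ne_one)

theorem moment_zero_two : moment 0 2 = 0 := moment_eq_zero (by norm_num)

theorem moment_one_two : moment 1 2 = 0 :=
  moment_eq_zero (by simpa using neg_I_ne_one)

theorem moment_two_one : moment 2 1 = 0 :=
  moment_eq_zero (by simpa using I_ne_one)

theorem cGram_zero_zero (r : ℝ) : cGram r 0 0 = 16 * Real.pi / 3 * 2 := by
  rw [cGram, (integral_cDensity_even r (by simp) (by simp)).2]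
  have : ∫ w, evenDensity r 0 0 w = moment 1 1 := by
    simp [evenDensity, dirPoly, moment]
  rw [this, moment_one_one]; ring

theorem cGram_zero_two (r : ℝ) : cGram r 0 2 = 0 := by
  rw [cGram, (integral_cDensity_even r (by simp) (by simp)).2]
  have : ∫ w, evenDensity r 0 2 w = moment 1 0 := by
    simp [evenDensity, dirPoly, moment]
  rw [this, moment_one_zero]; ring

theorem cGram_two_two (r : ℝ) : cGram r 2 2 = 16 * Real.pi / 3 * 4 := by
  rw [cGram, (integral_cDensity_even r (by simp) (by simp)).2]
  have : ∫ w, evenDensity r 2 2 w = moment 0 0 := by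
    simp [evenDensity, dirPoly, moment]
  rw [this, moment_zero_zero]; ring

theorem cGram_zero_four (r : ℝ) :
    cGram r 0 4 = 16 * Real.pi / 3 * (-(4 * Complex.I * r ^ 2)) := by
  rw [cGram, (integral_cDensity_even r (by simp) (by simp)).2]
  have : ∫ w, evenDensity r 0 4 w = moment 1 2 + -(2 * Complex.I * r ^ 2) * moment 1 1 := by
    rw [moment, moment, ← integral_const_mul, ← integral_add (integrable_moment (by norm_num))
      ((integrable_moment (by norm_num)).const_mul _)]
    congr 1; ext1 w
    simp [evenDensity, dirPoly, Complex.conj_ofNat]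
    ring
  rw [this, moment_one_one, moment_one_two]; ring

theorem cGram_two_four (r : ℝ) : cGram r 2 4 = 0 := by
  rw [cGram, (integral_cDensity_even r (by simp) (by simp)).2]
  have : ∫ w, evenDensity r 2 4 w = moment 0 2 + -(2 * Complex.I * r ^ 2) * moment 0 1 := by
    rw [moment, moment, ← integral_const_mul, ← integral_add (integrable_moment (by norm_num))
      ((integrable_moment (by norm_num)).const_mul _)]
    congr 1; ext1 w
    simp [evenDensity, dirPoly, Complex.conj_ofNat]
    ring
  rw [this, moment_zero_one, moment_zero_two]; ring

/-- In |w² + 2ir²w|² the cross terms integrate to zero by rotation. The term 4, coming from |w|⁴, is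
what keeps the even blocks invertible. -/
theorem cGram_four_four (r : ℝ) :
    cGram r 4 4 = 16 * Real.pi / 3 * (4 + 8 * r ^ 4) := by
  rw [cGram, (integral_cDensity_even r (by simp) (by simp)).2]
  have : ∫ w, evenDensity r 4 4 w = moment 2 2 + -(2 * Complex.I * r ^ 2) * moment 2 1 +
      (2 * Complex.I * r ^ 2) * moment 1 2 + (4 * r ^ 4) * moment 1 1 := by
    have h22 := integrable_moment (a := 2) (b := 2) (by norm_num)
    have h21 := (integrable_moment (a := 2) (b := 1) (by norm_num)).const_mul
      (-(2 * Complex.I * r ^ 2))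
    have h12 := (integrable_moment (a := 1) (b := 2) (by norm_num)).const_mul
      (2 * Complex.I * r ^ 2)
    have h11 := (integrable_moment (a := 1) (b := 1) (by norm_num)).const_mul (4 * (r : ℂ) ^ 4)
    rw [moment, moment, moment, moment, ← integral_const_mul, ← integral_const_mul,
      ← integral_const_mul, ← integral_add h22 h21, ← integral_add (h22.fun_add h21) h12,
      ← integral_add ((h22.fun_add h21).fun_add h12) h11]
    congr 1; ext1 w
    simp [evenDensity, dirPoly, Complex.conj_ofNat]
    linear_combination (-4 * (r : ℂ) ^ 4 * w * (starRingEnd ℂ) w * (weight w : ℂ)) * Complex.I_sq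
  rw [this, moment_one_one, moment_two_two, moment_one_two, moment_two_one]; ring

end EvenEntries

/-! ### Odd entries, by expansion of |1 + w / (2ir²)| -/

section OddEntries

/-- The quotient of `w` by `2ir²`. -/
noncomputable def eta (r : ℝ) (w : ℂ) : ℂ := -Complex.I * ((2 * r ^ 2)⁻¹ : ℝ) * w

theorem eta_re (r : ℝ) (w : ℂ) : (eta r w).re = (2 * r ^ 2)⁻¹ * w.im := by
  simp [eta, -Complex.ofReal_inv, -mul_inv_rev]

theorem eta_im (r : ℝ) (w : ℂ) : (eta r w).im = -((2 * r ^ 2)⁻¹ * w.re) := by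
  simp [eta, -Complex.ofReal_inv, -mul_inv_rev]

theorem norm_eta (r : ℝ) (w : ℂ) : ‖eta r w‖ = (2 * r ^ 2)⁻¹ * ‖w‖ := by
  rw [eta, norm_mul, norm_mul, norm_neg, Complex.norm_I, one_mul, Complex.norm_real,
    Real.norm_of_nonneg (by positivity)]

theorem norm_add_eq_mul_norm_one_add_eta {r : ℝ} (hr : 0 < r) (w : ℂ) :
    ‖w + 2 * Complex.I * r ^ 2‖ = 2 * r ^ 2 * ‖1 + eta r w‖ := by
  have h : w + 2 * Complex.I * r ^ 2 = 2 * Complex.I * r ^ 2 * (1 + eta r w) := by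
    have : (r : ℂ) ≠ 0 := by exact_mod_cast hr.ne'
    rw [eta]
    push_cast
    field_simp
    linear_combination w * Complex.I_sq
  rw [h, norm_mul]
  simp

/-- The weighted integral of `g |1 + w / (2ir²)|`. -/
noncomputable def oddIntegral (r : ℝ) (g : ℂ → ℝ) : ℝ := ∫ w, g w * ‖1 + eta r w‖ * weight w

theorem continuous_eta (r : ℝ) : Continuous (eta r) := by unfold eta; fun_prop

theorem integrable_mul_weight_of_le {g : ℂ → ℝ} (hg : Continuous g) {n : ℕ} (hn : n ≤ 5)
    (h : ∀ w, |g w| ≤ ‖w‖ ^ n) : Integrable fun w => g w * weight w := by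
  refine integrable_mul_weight hg 1 fun w => ?_
  rw [one_mul]
  calc |g w| ≤ ‖w‖ ^ n := h w
    _ ≤ (1 + ‖w‖) ^ n := by gcongr; simp
    _ ≤ _ := pow_le_pow_right₀ (by simp) hn

theorem integrable_oddIntegral (r : ℝ) {g : ℂ → ℝ} (hg : Continuous g) {n : ℕ} (hn : n ≤ 4)
    (h : ∀ w, |g w| ≤ ‖w‖ ^ n) : Integrable fun w => g w * ‖1 + eta r w‖ * weight w := by
  have := continuous_eta r
  refine integrable_mul_weight (by fun_prop) (1 + (2 * r ^ 2)⁻¹) fun w => ?_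
  have hw := norm_nonneg w
  have hk : 0 ≤ (2 * r ^ 2)⁻¹ := by positivity
  have h1 : ‖1 + eta r w‖ ≤ (1 + (2 * r ^ 2)⁻¹) * (1 + ‖w‖) := by
    refine (norm_add_le _ _).trans ?_
    rw [norm_eta, norm_one]
    nlinarith
  have h2 : |g w| ≤ (1 + ‖w‖) ^ 4 :=
    calc |g w| ≤ ‖w‖ ^ n := h w
      _ ≤ (1 + ‖w‖) ^ n := by gcongr; simp
      _ ≤ _ := pow_le_pow_right₀ (by simp) hn
  rw [abs_mul, abs_norm]
  calc _ ≤ (1 + ‖w‖) ^ 4 * ((1 + (2 * r ^ 2)⁻¹) * (1 + ‖w‖)) := by gcongr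
    _ = _ := by ring

/-- Expansion of `oddIntegral` to third order, with the moments of `g` as coefficients. -/
theorem abs_oddIntegral_sub_le {r : ℝ} {g : ℂ → ℝ} (hg : Continuous g) {n : ℕ}
    (hn : n ≤ 2) (h : ∀ w, |g w| ≤ ‖w‖ ^ n) :
    |oddIntegral r g - ((∫ w, g w * weight w) + (2 * r ^ 2)⁻¹ * (∫ w, g w * w.im * weight w) +
      (2 * r ^ 2)⁻¹ ^ 2 / 2 * ∫ w, g w * w.re ^ 2 * weight w)| ≤
      25 * (2 * r ^ 2)⁻¹ ^ 3 * ∫ w : ℂ, ‖w‖ ^ (n + 3) * weight w := by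
  set k := (2 * r ^ 2)⁻¹ with hk
  have hk0 : 0 ≤ k := by positivity
  have him : Continuous Complex.im := Complex.continuous_im
  have hre : Continuous Complex.re := Complex.continuous_re
  have i0 : Integrable fun w => g w * weight w :=
    integrable_mul_weight_of_le hg (hn.trans (by norm_num)) h
  have i1 : Integrable fun w => k * (g w * w.im * weight w) :=
    (integrable_mul_weight_of_le (g := fun w => g w * w.im) (hg.mul him) (n := n + 1) (by omega) fun w => by
      rw [abs_mul, pow_succ]
      exact mul_le_mul (h w) (Complex.abs_im_le_norm w) (abs_nonneg _) (by positivity)).const_mul k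
  have i2 : Integrable fun w => k ^ 2 / 2 * (g w * w.re ^ 2 * weight w) :=
    (integrable_mul_weight_of_le (g := fun w => g w * w.re ^ 2) (hg.mul (hre.pow 2)) (n := n + 2) (by omega) fun w => by
      rw [abs_mul, pow_add, abs_pow]
      exact mul_le_mul (h w) (pow_le_pow_left₀ (abs_nonneg _) (Complex.abs_re_le_norm w) 2)
        (by positivity) (by positivity)).const_mul (k ^ 2 / 2)
  have i3 := integrable_oddIntegral r hg (hn.trans (by norm_num)) h
  -- The cubic remainder raises the degree to n + 3 ≤ 5, the largest that the weight can integrate;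
  -- this is why n ≤ 2.
  have i4 : Integrable fun w : ℂ => 25 * k ^ 3 * (‖w‖ ^ (n + 3) * weight w) :=
    (integrable_norm_pow_mul_weight (by omega)).const_mul _
  rw [oddIntegral, ← integral_const_mul, ← integral_const_mul, ← integral_const_mul,
    ← integral_add i0 i1, ← integral_add (i0.fun_add i1) i2, ← integral_sub i3 ((i0.fun_add i1).fun_add i2)]
  rw [← Real.norm_eq_abs]
  refine norm_integral_le_of_norm_le i4 (Eventually.of_forall fun w => ?_)
  -- Division by 2ir² turns by a right angle: Re η is a multiple of Im w and Im η of Re w, so the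
  -- linear term has the moment of Im w and the quadratic one that of (Re w)².
  have hb := abs_norm_one_add_sub_le (eta r w)
  rw [eta_re, eta_im, norm_eta, ← hk] at hb
  have hW := weight_nonneg w
  simp only [Real.norm_eq_abs]
  have : g w * ‖1 + eta r w‖ * weight w - (g w * weight w + k * (g w * w.im * weight w) +
      k ^ 2 / 2 * (g w * w.re ^ 2 * weight w)) =
      g w * (‖1 + eta r w‖ - (1 + k * w.im + (-(k * w.re)) ^ 2 / 2)) * weight w := by ring
  rw [this, abs_mul, abs_mul, abs_of_nonneg hW]
  calc _ ≤ ‖w‖ ^ n * (25 * (k * ‖w‖) ^ 3) * weight w := by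
        gcongr; exact h w
    _ = _ := by ring

/-- A quarter turn exchanges (Re w)² and (Im w)², whose sum is |w|². -/
theorem integral_re_sq_mul_radial (f : ℝ → ℝ) (hf : Integrable fun w : ℂ => w.re ^ 2 * f ‖w‖) :
    ∫ w : ℂ, w.re ^ 2 * f ‖w‖ = 1 / 2 * ∫ w : ℂ, ‖w‖ ^ 2 * f ‖w‖ ∧
      ∫ w : ℂ, w.im ^ 2 * f ‖w‖ = 1 / 2 * ∫ w : ℂ, ‖w‖ ^ 2 * f ‖w‖ := by
  have h1 : ∫ w : ℂ, w.im ^ 2 * f ‖w‖ = ∫ w : ℂ, w.re ^ 2 * f ‖w‖ := by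
    rw [← integral_comp_I_mul fun w : ℂ => w.re ^ 2 * f ‖w‖]
    simp
  have h2 : Integrable fun w : ℂ => w.im ^ 2 * f ‖w‖ := by
    have := ((rotation (Circle.exp (Real.pi / 2))).measurePreserving.integrable_comp_emb
      (rotation (Circle.exp (Real.pi / 2))).toHomeomorph.measurableEmbedding).mpr hf
    refine this.congr (Eventually.of_forall fun w => ?_)
    simp [rotation_apply, Circle.coe_exp, Complex.exp_pi_div_two_mul_I]
  have h3 : ∫ w : ℂ, ‖w‖ ^ 2 * f ‖w‖ =
      (∫ w : ℂ, w.re ^ 2 * f ‖w‖) + ∫ w : ℂ, w.im ^ 2 * f ‖w‖ := by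
    rw [← integral_add hf h2]
    congr 1; ext1 w
    rw [← add_mul, ← norm_sq_eq]
  rw [h3, h1]
  constructor <;> ring

/-- The normalized diagonal entry belonging to the direction `z`. -/
noncomputable def lambdaOne (r : ℝ) : ℝ := 24 / Real.pi * oddIntegral r fun _ => 1

/-- The normalized diagonal entry belonging to the direction `z Ψ`. -/
noncomputable def lambdaTwo (r : ℝ) : ℝ := 24 / Real.pi * oddIntegral r fun w => ‖w‖ ^ 2

/-- The normalized mixed entry of the directions `z` and `z Ψ`. -/
noncomputable def sigma (r : ℝ) : ℝ := 24 / Real.pi * oddIntegral r fun w => -w.im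

theorem isBigO_zpow_neg_six {f : ℝ → ℝ} {C : ℝ}
    (h : ∀ r : ℝ, |f r| ≤ 25 * (2 * r ^ 2)⁻¹ ^ 3 * C) :
    (fun r => 24 / Real.pi * f r) =O[atTop] fun r : ℝ => r ^ (-6 : ℤ) := by
  -- The 8 is the cube of the 2 in (2r²)⁻¹.
  refine (IsBigO.of_bound (25 / 8 * C) (Eventually.of_forall fun r => ?_)).const_mul_left _
  have : ‖r ^ (-6 : ℤ)‖ = (r ^ 6)⁻¹ := by
    rw [Real.norm_eq_abs, show r ^ (-6 : ℤ) = (r ^ 6)⁻¹ by rw [zpow_neg]; norm_cast]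
    exact abs_of_nonneg (by positivity)
  rw [this, Real.norm_eq_abs]
  refine (h r).trans (le_of_eq ?_)
  rw [inv_pow, mul_pow, mul_inv]
  ring

theorem zpow_neg_two_eq (r : ℝ) : r ^ (-2 : ℤ) = (r ^ 2)⁻¹ := by rw [zpow_neg]; norm_cast

theorem zpow_neg_four_eq (r : ℝ) : r ^ (-4 : ℤ) = (r ^ 4)⁻¹ := by rw [zpow_neg]; norm_cast

theorem weight_integrals_one :
    (∫ w : ℂ, (1 : ℝ) * w.im * weight w = 0) ∧
      ∫ w : ℂ, (1 : ℝ) * w.re ^ 2 * weight w = Real.pi / 12 := by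
  constructor
  · exact integral_eq_zero_of_odd fun w => by rw [weight_neg]; simp
  · simp only [one_mul]
    have := (integral_re_sq_mul_radial (fun y => (1 + y ^ 2)⁻¹ ^ 4)
      (integrable_mul_weight_of_le (n := 2) (g := fun w => w.re ^ 2)
        (Complex.continuous_re.pow 2) (by norm_num) fun w => by
          rw [abs_pow]
          exact pow_le_pow_left₀ (abs_nonneg _) (Complex.abs_re_le_norm w) 2)).1
    refine this.trans ?_
    rw [show ∫ w : ℂ, ‖w‖ ^ 2 * (1 + ‖w‖ ^ 2)⁻¹ ^ 4 = Real.pi / 6 from integral_norm_sq_mul_weight]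
    ring

theorem weight_integrals_norm_sq :
    (∫ w : ℂ, ‖w‖ ^ 2 * w.im * weight w = 0) ∧
      ∫ w : ℂ, ‖w‖ ^ 2 * w.re ^ 2 * weight w = Real.pi / 6 := by
  constructor
  · exact integral_eq_zero_of_odd fun w => by rw [weight_neg]; simp
  · have hi := integrable_mul_weight_of_le (n := 4) (g := fun w => w.re ^ 2 * ‖w‖ ^ 2)
        (by fun_prop) (by norm_num) fun w => by
          rw [abs_mul, abs_pow, abs_pow, abs_norm, show (4 : ℕ) = 2 + 2 from rfl, pow_add]
          gcongr
          exact Complex.abs_re_le_norm w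
    simp only [mul_assoc] at hi
    have := (integral_re_sq_mul_radial (fun y => y ^ 2 * (1 + y ^ 2)⁻¹ ^ 4) hi).1
    calc _ = _ := by congr 1; ext1 w; rw [weight]; ring
      _ = _ := this
      _ = 1 / 2 * ∫ w : ℂ, ‖w‖ ^ 4 * weight w := by
        congr 2; ext1 w; rw [weight]; ring
      _ = _ := by rw [integral_norm_pow_four_mul_weight]; ring

theorem weight_integrals_im :
    (∫ w : ℂ, -w.im * weight w = 0) ∧ (∫ w : ℂ, -w.im * w.im * weight w = -(Real.pi / 12)) ∧
      ∫ w : ℂ, -w.im * w.re ^ 2 * weight w = 0 := by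
  refine ⟨?_, ?_, ?_⟩
  · exact integral_eq_zero_of_odd fun w => by rw [weight_neg]; simp
  · have := (integral_re_sq_mul_radial (fun y => (1 + y ^ 2)⁻¹ ^ 4)
      (integrable_mul_weight_of_le (n := 2) (g := fun w => w.re ^ 2)
        (Complex.continuous_re.pow 2) (by norm_num) fun w => by
          rw [abs_pow]
          exact pow_le_pow_left₀ (abs_nonneg _) (Complex.abs_re_le_norm w) 2)).2
    rw [show ∫ w : ℂ, ‖w‖ ^ 2 * (1 + ‖w‖ ^ 2)⁻¹ ^ 4 = Real.pi / 6
      from integral_norm_sq_mul_weight] at this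
    calc _ = -∫ w : ℂ, w.im ^ 2 * (1 + ‖w‖ ^ 2)⁻¹ ^ 4 := by
          rw [← integral_neg]; congr 1; ext1 w; rw [weight]; ring
      _ = _ := by rw [this]; ring
  · exact integral_eq_zero_of_odd fun w => by rw [weight_neg]; simp

theorem lambdaOne_isBigO : (fun r => lambdaOne r - (8 + 1 / 4 * r ^ (-4 : ℤ))) =O[atTop]
    fun r : ℝ => r ^ (-6 : ℤ) := by
  have h := isBigO_zpow_neg_six fun r => abs_oddIntegral_sub_le (r := r) (g := fun _ => 1)
    continuous_const (n := 0) (by norm_num) (by simp)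
  refine h.congr_left fun r => ?_
  rw [lambdaOne, weight_integrals_one.1, weight_integrals_one.2]
  simp only [one_mul]
  rw [integral_weight, zpow_neg_four_eq]
  have := Real.pi_ne_zero
  field_simp
  ring

theorem lambdaTwo_isBigO : (fun r => lambdaTwo r - (4 + 1 / 2 * r ^ (-4 : ℤ))) =O[atTop]
    fun r : ℝ => r ^ (-6 : ℤ) := by
  have h := isBigO_zpow_neg_six fun r => abs_oddIntegral_sub_le (r := r) (g := fun w => ‖w‖ ^ 2)
    (by fun_prop) (n := 2) (by norm_num) (by simp)
  refine h.congr_left fun r => ?_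
  rw [lambdaTwo, weight_integrals_norm_sq.1, weight_integrals_norm_sq.2,
    integral_norm_sq_mul_weight, zpow_neg_four_eq]
  have := Real.pi_ne_zero
  field_simp
  ring

theorem sigma_isBigO : (fun r => sigma r + r ^ (-2 : ℤ)) =O[atTop]
    fun r : ℝ => r ^ (-6 : ℤ) := by
  have h := isBigO_zpow_neg_six fun r => abs_oddIntegral_sub_le (r := r) (g := fun w => -w.im)
    Complex.continuous_im.neg (n := 1) (by norm_num)
    (fun w => by simpa using Complex.abs_im_le_norm w)
  refine h.congr_left fun r => ?_
  rw [sigma, weight_integrals_im.1, weight_integrals_im.2.1, weight_integrals_im.2.2,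
    zpow_neg_two_eq]
  have := Real.pi_ne_zero
  field_simp
  ring

/-- The reflection w ↦ -w̄ changes the sign of Re w and conjugates η, so it preserves |1 + η|. This
makes the mixed odd entry purely imaginary. -/
theorem oddIntegral_re (r : ℝ) : oddIntegral r (fun w => w.re) = 0 := by
  have h1 := integral_comp_conj fun w => w.re * ‖1 + eta r w‖ * weight w
  rw [← integral_neg_eq_self] at h1
  have h2 : ∀ w : ℂ, (starRingEnd ℂ (-w)).re * ‖1 + eta r (starRingEnd ℂ (-w))‖ *
      weight (starRingEnd ℂ (-w)) = -(w.re * ‖1 + eta r w‖ * weight w) := by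
    intro w
    have : ‖1 + eta r (starRingEnd ℂ (-w))‖ = ‖1 + eta r w‖ := by
      rw [← RCLike.norm_conj (1 + eta r w)]
      congr 1
      simp [eta, Complex.conj_ofNat]
    rw [this, weight_conj, weight_neg]
    simp
  simp only [h2] at h1
  rw [integral_neg] at h1
  rw [oddIntegral]
  linarith

theorem cGram_one_one {r : ℝ} (hr : 0 < r) :
    cGram r 1 1 = 16 * Real.pi / 3 * (r ^ 2 * lambdaOne r) := by
  rw [cGram, (integral_cDensity_odd r (by simp) (by simp)).2]
  have : ∫ w, oddDensity r 1 1 w = ((2 * r ^ 2 * oddIntegral r fun _ => 1 : ℝ) : ℂ) := by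
    rw [oddIntegral, ← integral_const_mul, ← integral_complex_ofReal]
    congr 1; ext1 w
    rw [oddDensity, norm_add_eq_mul_norm_one_add_eta hr]
    simp [dirPoly, mul_assoc]
  -- The factor 24/π in `lambdaOne` is 64 · 2r² divided by (16π/3) r².
  rw [this, lambdaOne]
  have := Real.pi_ne_zero
  push_cast
  field_simp
  ring

theorem cGram_three_three {r : ℝ} (hr : 0 < r) :
    cGram r 3 3 = 16 * Real.pi / 3 * (r ^ 2 * lambdaTwo r) := by
  rw [cGram, (integral_cDensity_odd r (by simp) (by simp)).2]
  have : ∫ w, oddDensity r 3 3 w = ((2 * r ^ 2 * oddIntegral r fun w => ‖w‖ ^ 2 : ℝ) : ℂ) := by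
    rw [oddIntegral, ← integral_const_mul, ← integral_complex_ofReal]
    congr 1; ext1 w
    rw [oddDensity, norm_add_eq_mul_norm_one_add_eta hr]
    simp only [dirPoly]
    simp [Complex.mul_conj, Complex.normSq_eq_norm_sq]
    ring
  rw [this, lambdaTwo]
  have := Real.pi_ne_zero
  push_cast
  field_simp
  ring

theorem cGram_one_three {r : ℝ} (hr : 0 < r) :
    cGram r 1 3 = 16 * Real.pi / 3 * (Complex.I * (r ^ 2 * sigma r)) := by
  rw [cGram, (integral_cDensity_odd r (by simp) (by simp)).2]
  have : ∫ w, oddDensity r 1 3 w = ((2 * r ^ 2 * oddIntegral r fun w => w.re : ℝ) : ℂ) +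
      Complex.I * ((2 * r ^ 2 * oddIntegral r fun w => -w.im : ℝ) : ℂ) := by
    have h1 := ((integrable_oddIntegral r Complex.continuous_re (n := 1) (by norm_num)
      fun w => by simpa using Complex.abs_re_le_norm w).const_mul (2 * r ^ 2)).ofReal (𝕜 := ℂ)
    have h2 := (((integrable_oddIntegral r Complex.continuous_im.neg (n := 1) (by norm_num)
      fun w => by simpa using Complex.abs_im_le_norm w).const_mul
        (2 * r ^ 2)).ofReal (𝕜 := ℂ)).const_mul Complex.I
    rw [oddIntegral, oddIntegral, ← integral_const_mul, ← integral_const_mul,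
      ← integral_complex_ofReal, ← integral_complex_ofReal, ← integral_const_mul]
    refine Eq.trans ?_ (integral_add h1 h2)
    congr 1; ext1 w
    rw [oddDensity, norm_add_eq_mul_norm_one_add_eta hr]
    have hw : starRingEnd ℂ w = w.re - w.im * Complex.I := by
      apply Complex.ext <;> simp
    simp only [dirPoly]
    simp [hw]
    ring
  rw [this, oddIntegral_re, sigma]
  have := Real.pi_ne_zero
  push_cast
  field_simp
  ring

end OddEntries

/-! ### Assembly of the four blocks -/

/-- The values of `cGram`, up to the factor `16π/3`. -/
noncomputable def cGramTable (r : ℝ) : Matrix (Fin 5) (Fin 5) ℂ :=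
  !![2, 0, 0, 0, -(4 * Complex.I * r ^ 2);
     0, r ^ 2 * lambdaOne r, 0, Complex.I * (r ^ 2 * sigma r), 0;
     0, 0, 4, 0, 0;
     0, -(Complex.I * (r ^ 2 * sigma r)), 0, r ^ 2 * lambdaTwo r, 0;
     4 * Complex.I * r ^ 2, 0, 0, 0, 4 + 8 * r ^ 4]

theorem cGram_eq {r : ℝ} (hr : 0 < r) (k l : Fin 5) :
    cGram r k l = ((16 * Real.pi / 3 : ℝ) : ℂ) * cGramTable r k l := by
  have h31 := cGram_conj r 1 3
  have h40 := cGram_conj r 0 4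
  have h20 := cGram_conj r 0 2
  have h42 := cGram_conj r 2 4
  rw [cGram_one_three hr] at h31
  rw [cGram_zero_four] at h40
  rw [cGram_zero_two] at h20
  rw [cGram_two_four] at h42
  fin_cases k <;> fin_cases l <;> simp only [cGramTable] <;>
    simp [cGram_zero_zero, cGram_zero_two, cGram_two_two, cGram_zero_four, cGram_two_four,
      cGram_four_four, cGram_one_one hr, cGram_three_three hr, cGram_one_three hr, h31, h40, h20,
      h42, cGram_even_odd, cGram_odd_even, Complex.conj_ofNat]

theorem gramR_apply_table {r : ℝ} (hr : 0 < r) (i j : Fin 10) :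
    gramR r i j = (16 * Real.pi / 3) * (r ^ beta i * r ^ beta j *
      (cUnit i * starRingEnd ℂ (cUnit j) * cGramTable r (cIndex i) (cIndex j)).re) := by
  rw [gramR_apply, cGram_eq hr, mul_left_comm (cUnit i * _), Complex.re_ofReal_mul]
  ring

/-- The block of the indices `1, 10, 6` (for `s = 1`) or `2, 9, 5` (for `s = -1`). -/
noncomputable def evenBlock (s r : ℝ) : Matrix (Fin 3) (Fin 3) ℝ :=
  !![2, -4 * s, 0; -4 * s, 8 + 4 * r ^ (-4 : ℤ), 0; 0, 0, 4]

/-- The block of the indices `3, 8` (for `s = 1`) or `4, 7` (for `s = -1`). -/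
noncomputable def oddBlock (s r : ℝ) : Matrix (Fin 2) (Fin 2) ℝ :=
  !![lambdaOne r, s * sigma r; s * sigma r, lambdaTwo r]

theorem order_apply (x : (Fin 3 ⊕ Fin 3) ⊕ (Fin 2 ⊕ Fin 2)) :
    order x = Sum.elim (Sum.elim ![0, 9, 5] ![1, 8, 4]) (Sum.elim ![2, 7] ![3, 6]) x := rfl

/-- The off-diagonal entries of `cGramTable` are purely imaginary, so they couple the real direction
of one complex parameter only to the imaginary direction of another. Exchanging the two roles
changes the sign, whence `s`. -/
theorem gramR_submatrix {r : ℝ} (hr : 0 < r) :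
    (gramR r).submatrix order order = (16 * Real.pi / 3) •
      Matrix.fromBlocks (Matrix.fromBlocks (evenBlock 1 r) 0 0 (evenBlock (-1) r)) 0 0
        (Matrix.fromBlocks (oddBlock 1 r) 0 0 (oddBlock (-1) r)) := by
  have h1 : r ^ (-1 : ℤ) = r⁻¹ := zpow_neg_one r
  have h2 := zpow_neg_two_eq r
  have h4 := zpow_neg_four_eq r
  have hr0 := hr.ne'
  have e2 : ((r : ℂ) ^ 2).re = r ^ 2 := by norm_cast
  have e2' : ((r : ℂ) ^ 2).im = 0 := by norm_cast
  have e4 : ((r : ℂ) ^ 4).re = r ^ 4 := by norm_cast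
  have e4' : ((r : ℂ) ^ 4).im = 0 := by norm_cast
  ext a b
  rw [Matrix.submatrix_apply, Matrix.smul_apply, gramR_apply_table hr, order_apply, order_apply,
    smul_eq_mul]
  congr 1
  rcases a with (a | a) | (a | a) <;> rcases b with (b | b) | (b | b) <;>
    fin_cases a <;> fin_cases b <;>
    simp [beta, cUnit, cIndex, cGramTable, evenBlock, oddBlock, h1, h2, h4, e2, e2', e4, e4',
      -zpow_neg] <;> field_simp <;> ring

/-! ### The determinant -/

/-- In the even blocks the leading terms cancel: 4 (2 (8 + 4r⁻⁴) - 16) = 32r⁻⁴. The constant 2⁵⁰ is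
16¹⁰ · 32². -/
theorem det_gramR {r : ℝ} (hr : 0 < r) :
    (gramR r).det = 2 ^ 50 * Real.pi ^ 10 / 3 ^ 10 * r ^ (-8 : ℤ) *
      (lambdaOne r * lambdaTwo r - sigma r ^ 2) ^ 2 := by
  have hE : ∀ s : ℝ, s ^ 2 = 1 → (evenBlock s r).det = 32 * r ^ (-4 : ℤ) := fun s hs => by
    simp only [evenBlock, Matrix.det_fin_three, Matrix.of_apply, Matrix.cons_val', Matrix.cons_val]
    linear_combination -64 * hs
  have hO : ∀ s : ℝ, s ^ 2 = 1 → (oddBlock s r).det =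
      lambdaOne r * lambdaTwo r - sigma r ^ 2 := fun s hs => by
    simp only [oddBlock, Matrix.det_fin_two, Matrix.of_apply, Matrix.cons_val', Matrix.cons_val]
    linear_combination -(sigma r) ^ 2 * hs
  have h8 : r ^ (-8 : ℤ) = r ^ (-4 : ℤ) * r ^ (-4 : ℤ) := by
    rw [← zpow_add₀ hr.ne']; norm_num
  rw [← Matrix.det_submatrix_equiv_self order, gramR_submatrix hr, Matrix.det_smul,
    Matrix.det_fromBlocks_zero₂₁, Matrix.det_fromBlocks_zero₂₁, Matrix.det_fromBlocks_zero₂₁,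
    hE 1 (by norm_num), hE (-1) (by norm_num), hO 1 (by norm_num), hO (-1) (by norm_num), h8]
  simp only [Fintype.card_sum, Fintype.card_fin]
  ring

theorem zpow_isBigO_zpow {a b : ℤ} (h : a ≤ b) :
    (fun r : ℝ => r ^ a) =O[atTop] fun r : ℝ => r ^ b := by
  refine IsBigO.of_bound 1 ?_
  filter_upwards [eventually_ge_atTop 1] with r hr
  rw [one_mul, Real.norm_of_nonneg (by positivity), Real.norm_of_nonneg (by positivity)]
  exact zpow_le_zpow_right₀ hr h

theorem det_oddBlock_isBigO :
    (fun r => lambdaOne r * lambdaTwo r - sigma r ^ 2 - 32) =O[atTop]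
      fun r : ℝ => r ^ (-2 : ℤ) := by
  have h62 := zpow_isBigO_zpow (a := -6) (b := -2) (by norm_num)
  have h42 := zpow_isBigO_zpow (a := -4) (b := -2) (by norm_num)
  have h20 : (fun r : ℝ => r ^ (-2 : ℤ)) =O[atTop] fun _ => (1 : ℝ) := by
    simpa using zpow_isBigO_zpow (a := -2) (b := 0) (by norm_num)
  have h1 : (fun r => lambdaOne r - 8) =O[atTop] fun r : ℝ => r ^ (-2 : ℤ) := by
    refine ((lambdaOne_isBigO.trans h62).add (h42.const_mul_left (1 / 4))).congr_left fun r => ?_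
    ring
  have h2 : (fun r => lambdaTwo r - 4) =O[atTop] fun r : ℝ => r ^ (-2 : ℤ) := by
    refine ((lambdaTwo_isBigO.trans h62).add (h42.const_mul_left (1 / 2))).congr_left fun r => ?_
    ring
  have h3 : sigma =O[atTop] fun r : ℝ => r ^ (-2 : ℤ) := by
    refine ((sigma_isBigO.trans h62).sub (isBigO_refl _ _)).congr_left fun r => ?_
    ring
  have h12 : (fun r => (lambdaOne r - 8) * (lambdaTwo r - 4)) =O[atTop]
      fun r : ℝ => r ^ (-2 : ℤ) := by simpa using h1.mul (h2.trans h20)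
  have h33 : (fun r => sigma r * sigma r) =O[atTop] fun r : ℝ => r ^ (-2 : ℤ) := by
    simpa using h3.mul (h3.trans h20)
  refine ((((h1.const_mul_left 4).add (h2.const_mul_left 8)).add h12).sub h33).congr_left
    fun r => ?_
  ring

theorem det_gramR_isBigO :
    (fun r : ℝ => (gramR r).det - 2 ^ 60 * Real.pi ^ 10 / 3 ^ 10 * r ^ (-8 : ℤ)) =O[atTop]
      fun r : ℝ => r ^ (-10 : ℤ) := by
  have h := det_oddBlock_isBigO
  have h20 : (fun r : ℝ => r ^ (-2 : ℤ)) =O[atTop] fun _ => (1 : ℝ) := by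
    simpa using zpow_isBigO_zpow (a := -2) (b := 0) (by norm_num)
  -- With x the determinant of an odd block, x² - 32² = (x - 32)(x - 32 + 64), and 2⁵⁰ · 32² = 2⁶⁰.
  have hs : (fun r => lambdaOne r * lambdaTwo r - sigma r ^ 2 - 32 + 64) =O[atTop]
      fun _ : ℝ => (1 : ℝ) := (h.trans h20).add (isBigO_const_const _ one_ne_zero _)
  have hm := ((isBigO_refl (fun r : ℝ => r ^ (-8 : ℤ)) atTop).mul (h.mul hs)).const_mul_left
    (2 ^ 50 * Real.pi ^ 10 / 3 ^ 10)
  refine hm.congr' ?_ ?_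
  · filter_upwards [eventually_gt_atTop 0] with r hr
    rw [det_gramR hr]; ring
  · filter_upwards [eventually_gt_atTop 0] with r hr
    rw [mul_one, ← zpow_add₀ hr.ne']; norm_num

theorem tendsto_det_gramR : Tendsto (fun r : ℝ => (gramR r).det) atTop (𝓝 0) := by
  have h10 : Tendsto (fun r : ℝ => r ^ (-10 : ℤ)) atTop (𝓝 0) :=
    tendsto_zpow_atTop_zero (by norm_num)
  have h8 : Tendsto (fun r : ℝ => r ^ (-8 : ℤ)) atTop (𝓝 0) :=
    tendsto_zpow_atTop_zero (by norm_num)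
  have := (det_gramR_isBigO.trans_tendsto h10).add
    (h8.const_mul (2 ^ 60 * Real.pi ^ 10 / 3 ^ 10))
  simpa using this

theorem isBigO_of_eq_zero {f g : ℝ → ℝ} (h : ∀ r, f r = 0) : f =O[atTop] g := by
  rw [show f = fun _ => 0 from funext h]
  exact isBigO_zero _ _

end HarmonicGram

theorem proposition4p3 :
    -- the partial derivatives and the integrals that define the matrix exist
    (∀ r : ℝ, 0 < r →
      (∀ z : ℂ, DifferentiableAt ℝ (HarmonicGram.sphereMap (HarmonicGram.alphaR r)) z) ∧
      (∀ (i : Fin 10) (z : ℂ), DifferentiableAt ℝ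
        (fun t : ℝ => HarmonicGram.sphereMap (Function.update (HarmonicGram.alphaR r) i t) z)
        (HarmonicGram.alphaR r i)) ∧
      (∀ i j : Fin 10, Integrable
        (HarmonicGram.gramIntegrand r (HarmonicGram.alphaR r) i j) (volume : Measure ℂ))) ∧
    -- block diagonal form, with the expansion of the four blocks
    (∃ (A₁ A₂ : ℝ → Matrix (Fin 3) (Fin 3) ℝ) (A₃ A₄ : ℝ → Matrix (Fin 2) (Fin 2) ℝ)
        (α₀ β₀ γ₀ : ℝ → ℝ),
      (∀ r : ℝ, 0 < r →
        (HarmonicGram.gramR r).submatrix HarmonicGram.order HarmonicGram.order =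
          (16 * Real.pi / 3) • Matrix.fromBlocks
            (Matrix.fromBlocks (A₁ r) 0 0 (A₂ r)) 0 0 (Matrix.fromBlocks (A₃ r) 0 0 (A₄ r))) ∧
      (α₀ =O[atTop] fun r : ℝ => r ^ (-(9 / 2) : ℝ)) ∧
      (β₀ =O[atTop] fun r : ℝ => r ^ (-(9 / 2) : ℝ)) ∧
      (γ₀ =O[atTop] fun r : ℝ => r ^ (-(9 / 2) : ℝ)) ∧
      (∀ i j : Fin 3, (fun r : ℝ => A₁ r i j -
          !![2, -4, α₀ r;
             -4, 8 + 4 * r ^ (-4 : ℤ), γ₀ r;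
             α₀ r, γ₀ r, 4] i j) =O[atTop] fun r : ℝ => r ^ (-6 : ℤ)) ∧
      (∀ i j : Fin 3, (fun r : ℝ => A₂ r i j -
          !![2, 4, -α₀ r;
             4, 8 + 4 * r ^ (-4 : ℤ), γ₀ r;
             -α₀ r, γ₀ r, 4] i j) =O[atTop] fun r : ℝ => r ^ (-6 : ℤ)) ∧
      (∀ i j : Fin 2, (fun r : ℝ => A₃ r i j -
          !![8 + 1 / 4 * r ^ (-4 : ℤ), β₀ r - r ^ (-2 : ℤ);
             β₀ r - r ^ (-2 : ℤ), 4 + 1 / 2 * r ^ (-4 : ℤ)] i j)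
          =O[atTop] fun r : ℝ => r ^ (-6 : ℤ)) ∧
      (∀ i j : Fin 2, (fun r : ℝ => A₄ r i j -
          !![8 + 1 / 4 * r ^ (-4 : ℤ), r ^ (-2 : ℤ) - β₀ r;
             r ^ (-2 : ℤ) - β₀ r, 4 + 1 / 2 * r ^ (-4 : ℤ)] i j)
          =O[atTop] fun r : ℝ => r ^ (-6 : ℤ))) ∧
    -- the determinant, and its degeneration
    ((fun r : ℝ => (HarmonicGram.gramR r).det -
        2 ^ 60 * Real.pi ^ 10 / 3 ^ 10 * r ^ (-8 : ℤ)) =O[atTop] fun r : ℝ => r ^ (-10 : ℤ)) ∧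
    Tendsto (fun r : ℝ => (HarmonicGram.gramR r).det) atTop (𝓝 0) := by
  -- The corrections α₀, β₀, γ₀ may all be zero: the even blocks are exact, and `sigma r` differs
  -- from -r⁻² only by O(r⁻⁶).
  refine ⟨fun r _ => ⟨fun z => ?_, fun i z =>
      (HarmonicGram.hasDerivAt_sphereMap_update r i z).differentiableAt,
      HarmonicGram.integrable_gramIntegrand r⟩,
    ⟨HarmonicGram.evenBlock 1, HarmonicGram.evenBlock (-1), HarmonicGram.oddBlock 1,
      HarmonicGram.oddBlock (-1), 0, 0, 0, fun r hr => HarmonicGram.gramR_submatrix hr,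
      isBigO_zero _ _, isBigO_zero _ _, isBigO_zero _ _, ?_, ?_, ?_, ?_⟩,
    HarmonicGram.det_gramR_isBigO, HarmonicGram.tendsto_det_gramR⟩
  · rw [HarmonicGram.sphereMap_alphaR]
    exact (HarmonicGram.differentiable_stereo _).comp z
      ((HarmonicGram.hasDerivAt_psi r z).differentiableAt.restrictScalars ℝ)
  · intro i j
    refine HarmonicGram.isBigO_of_eq_zero fun r => ?_
    fin_cases i <;> fin_cases j <;> simp [HarmonicGram.evenBlock]
  · intro i j
    refine HarmonicGram.isBigO_of_eq_zero fun r => ?_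
    fin_cases i <;> fin_cases j <;> simp [HarmonicGram.evenBlock]
  · have h1 := HarmonicGram.lambdaOne_isBigO
    have h2 := HarmonicGram.lambdaTwo_isBigO
    have h3 := HarmonicGram.sigma_isBigO
    intro i j
    fin_cases i <;> fin_cases j
    · exact h1
    · exact h3.congr_left fun r => by simp [HarmonicGram.oddBlock]
    · exact h3.congr_left fun r => by simp [HarmonicGram.oddBlock]
    · exact h2
  · have h1 := HarmonicGram.lambdaOne_isBigO
    have h2 := HarmonicGram.lambdaTwo_isBigO
    have h3 := HarmonicGram.sigma_isBigO.neg_left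
    intro i j
    fin_cases i <;> fin_cases j
    · exact h1
    · exact h3.congr_left fun r => by simp [HarmonicGram.oddBlock]; ring
    · exact h3.congr_left fun r => by simp [HarmonicGram.oddBlock]; ring
    · exact h2
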